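/- Let $A,B,C$ be finite sets, $A\neq\emptyset$, and let $\theta$ be a finite non-empty index set. A compound wiretap channel $\mathfrak W$ is a family of pairs of stochastic matrices $W_t:A\to\mathcal P(B)$ (to the legitimate receiver) and $V_t:A\to\mathcal P(C)$ (to the eavesdropper), $t\in\theta$; let $W_t^{\otimes n},V_t^{\otimes n}$ be their $n$-th memoryless extensions. An $(n,J_n)$ code without channel state information (CSI) consists of a stochastic encoder $E:\{1,\dots,J_n\}\to\mathcal P(A^n)$ and mutually disjoint decoding sets $D_j\subset B^n$, $1\le j\le J_n$ (with $J_n\ge1$), none of which depends on $t$. A number $R\ge 0$ is an achievable secrecy rate if there is a sequence of $(n,J_n)$ codes, $n\in\mathbb N$, with $$\lim_{n\to\infty}\max_{t}\max_{j}\sum_{x^n\in A^n}E(x^n|j)\,W_t^{\otimes n}(D_j^c|x^n)=0,\qquad \liminf_{n\to\infty}\tfrac1n\log_2 J_n\ge R,\qquad \lim_{n\to\infty}\max_{t}I(J;Z_t^n)=0,$$ where $J$ is uniformly distributed on $\{1,\dots,J_n\}$ and $Z_t^n$ is the resulting output of $V_t^{\otimes n}$. The secrecy capacity $C_S(\mathfrak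 W)$ without CSI is the largest achievable secrecy rate. Mutual information is measured in bits. Theorem. The secrecy capacity $C_S(\mathfrak W)$ (the largest achievable secrecy rate) exists, and $$C_S(\mathfrak W)\ \ge\ \max_{U\to X\to Y_tZ_t}\Big(\min_{t\in\theta}I(U;Y_t)-\max_{t\in\theta}I(U;Z_t)\Big),$$ where the maximum exists and is over all random variables $U$ with finitely many values and $X$ with values in $A$ such that, for every $t$, $U\to X\to Y_tZ_t$ is a Markov chain and $X$ is connected to $Y_t$ via $W_t$ and to $Z_t$ via $V_t$. Moreover, for every $n$ the maximum in the following display (over $U$ with finitely many values and $X$ with values in $A^n$, where $Y_t^n,Z_t^n$ are the outputs of $W_t^{\otimes n},V_t^{\otimes n}$ for the input $X$) exists, the limit exists and is finite, and $$C_S(\mathfrak W)\ \ge\ \lim_{n\to\infty}\frac1n\max_{U\to X\to Y_t^nZ_t^n}\Big(\min_{t\in\theta}I(U;Y_t^n)-\max_{t\in\theta}I(U;Z_t^n)\Big).$$ Conversely, $$C_S(\mathfrak W)\ \le\ \lim_{n\to\infty}\frac1n\max_{U\to X\to Y_t^nZ_t^n}\Big(\min_{t\in\theta}I(U;Y_t^n)-\max_{t\in\theta}I(U;Z_t^n)\Big).$$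 -/

import Mathlib

namespace CompoundWiretap

open Finset

/-- `𝒫 α`: the probability distributions on the finite set `α`. -/
abbrev Dist (α : Type*) [Fintype α] : Type _ := stdSimplex ℝ α

/-- A channel (stochastic matrix) from `α` to `β`; `W a b` is the probability `W(b | a)`. -/
abbrev Channel (α β : Type*) [Fintype β] : Type _ := α → Dist β

/-- The `n`-th memoryless extension `W^{⊗ n}(y^n | x^n) = ∏ i, W(y_i | x_i)`. -/
noncomputable def memoryless {α β : Type*} [Fintype β] (W : Channel α β) (n : ℕ) :
    Channel (Fin n → α) (Fin n → β) := fun x =>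
  ⟨fun y => ∏ i, W (x i) (y i), by
    classical
    refine ⟨fun y => Finset.prod_nonneg fun i _ => (W (x i)).2.1 (y i), ?_⟩
    have h := Finset.prod_univ_sum (fun _ : Fin n => (Finset.univ : Finset β))
      (fun i b => W (x i) b)
    rw [Fintype.piFinset_univ] at h
    rw [← h]
    exact Finset.prod_eq_one fun i _ => (W (x i)).2.2⟩

/-- The mutual information, in bits, of two random variables with joint probability mass
function `P`. Terms with `P u y = 0` vanish, and where `P u y > 0` both marginals are positive. -/
noncomputable def mutualInfo {υ β : Type*} [Fintype υ] [Fintype β] (P : υ → β → ℝ) : ℝ :=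
  ∑ u, ∑ y, P u y * Real.logb 2 (P u y / ((∑ y', P u y') * ∑ u', P u' y))

/-- The joint law of `(U, Y)` when `(U, X)` has law `P`, `U → X → Y` is a Markov chain and `X` is
connected to `Y` via `W`. -/
noncomputable def outputLaw {υ α β : Type*} [Fintype υ] [Fintype α] [Fintype β]
    (P : Dist (υ × α)) (W : Channel α β) : υ → β → ℝ :=
  fun u y => ∑ x, P (u, x) * W x y

section Compound

variable {θ A B C : Type*} [Fintype θ] [Fintype A] [Fintype B] [Fintype C]

/-- `min_t I(U; Y_t) - max_t I(U; Z_t)` for `U → X → Y_t Z_t` with `(U, X)` of law `P`. -/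
noncomputable def rateGap {υ : Type*} [Fintype υ] (W : θ → Channel A B) (V : θ → Channel A C)
    (P : Dist (υ × A)) : ℝ :=
  (⨅ t, mutualInfo (outputLaw P (W t))) - ⨆ t, mutualInfo (outputLaw P (V t))

/-- All values of `min_t I(U; Y_t) - max_t I(U; Z_t)`, where `U` ranges over the random variables
with finitely many values and `U → X → Y_t Z_t`. -/
def rateGaps (W : θ → Channel A B) (V : θ → Channel A C) : Set ℝ :=
  {r | ∃ (k : ℕ) (P : Dist (Fin k × A)), r = rateGap W V P}

/-- The values of `min_t I(U; Y_t^n) - max_t I(U; Z_t^n)` for the `n`-th memoryless extensions. -/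
def blockRateGaps (W : θ → Channel A B) (V : θ → Channel A C) (n : ℕ) : Set ℝ :=
  rateGaps (fun t => memoryless (W t) n) (fun t => memoryless (V t) n)

/-- An `(n, J)` code without channel state information: a stochastic encoder and mutually disjoint
decoding sets, neither of which depends on the channel index. -/
structure Code (A B : Type*) [Fintype A] (n J : ℕ) where
  /-- the stochastic encoder -/
  enc : Channel (Fin J) (Fin n → A)
  /-- the decoding sets -/
  dec : Fin J → Finset (Fin n → B)
  disjoint : ∀ i j, i ≠ j → Disjoint (dec i) (dec j)

/-- The maximum error probability
`max_t max_j ∑_{x^n} E(x^n | j) W_t^{⊗ n}(D_j^c | x^n)`. -/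
noncomputable def Code.error [DecidableEq B] {n J : ℕ} (c : Code A B n J)
    (W : θ → Channel A B) : ℝ :=
  ⨆ t, ⨆ j, ∑ x, c.enc j x * ∑ y ∈ (c.dec j)ᶜ, memoryless (W t) n x y

/-- The joint law of `(J, Z^n)`: the message `J` is uniformly distributed, it is encoded, and the
codeword is sent through the memoryless extension of the eavesdropper's channel `V`. -/
noncomputable def Code.leakLaw {n J : ℕ} (c : Code A B n J) (V : Channel A C) :
    Fin J → (Fin n → C) → ℝ :=
  fun j z => (1 / (J : ℝ)) * ∑ x, c.enc j x * memoryless V n x z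

/-- The leaked information `max_t I(J; Z_t^n)`. -/
noncomputable def Code.leakage {n J : ℕ} (c : Code A B n J) (V : θ → Channel A C) : ℝ :=
  ⨆ t, mutualInfo (c.leakLaw (V t))

/-- `R` is an achievable secrecy rate, with strong secrecy and without channel state information
at the transmitter or the legitimate receiver. -/
def IsAchievable [DecidableEq B] (W : θ → Channel A B) (V : θ → Channel A C) (R : ℝ) : Prop :=
  0 ≤ R ∧ ∃ (J : ℕ → ℕ) (c : ∀ n, Code A B n (J n)),
    (∀ n, 0 < J n) ∧
    Filter.Tendsto (fun n => (c n).error W) Filter.atTop (nhds 0) ∧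
    (R : EReal) ≤ Filter.liminf (fun n : ℕ => ((1 / (n : ℝ) * Real.logb 2 (J n) : ℝ) : EReal))
      Filter.atTop ∧
    Filter.Tendsto (fun n => (c n).leakage V) Filter.atTop (nhds 0)

/-- The secrecy capacity without channel state information. -/
noncomputable def secrecyCapacity [DecidableEq B] (W : θ → Channel A B) (V : θ → Channel A C) :
    ℝ :=
  sSup {R | IsAchievable W V R}

end Compound

end CompoundWiretap

namespace CompoundWiretap

open Finset

/-! Achievability is random coding. Fix a law of `(U, X)`, split as a law of `U` followed by a
prefix channel `U → X`, and draw i.i.d. words over the alphabet of `U`: about `2^(n (min I(U;Y) -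
max I(U;Z)))` messages, each with about `2^(n max I(U;Z))` codewords among which the encoder chooses
uniformly. There are few enough codewords in total for a decoder testing all states at once, since
an independent codeword passes a test at threshold `Γ` with probability at most `1/Γ`
(`sum_threshold_le`). There are enough codewords per message for the eavesdropper's output to be
close in divergence to one fixed law, whatever the message (`sum_iid_resolvability_le`). Both error
terms decay exponentially by a Chernoff argument, so the leakage itself, not only its rate,
vanishes. As `θ` is finite, the costs of all states are added, and discarding the worse half of the
messages turns an average bound into a bound for every message (`exists_codebook`).

Applied to the `m`-th extension and regrouped, this makes the block maximum divided by `m`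
achievable for every `m > 0`. Conversely, taking the uniform message as `U`, Fano's inequality and
the small leakage show that a good code of rate close to capacity has nearly that value as its block
gap. The normalised maxima thus lie below the capacity and come arbitrarily close to it, so their
limit exists and equals it, with no superadditivity argument (`tendsto_blockRateGaps`).

The maxima exist because the gap depends only on the law of `X` and the conditional output entropies
given `U`. These data range over the convex hull of a compact set, on which the gap is continuous
(`exists_isGreatest_rateGaps`). -/

lemma sub_le_mul_log_div {p q : ℝ} (hp : 0 ≤ p) (hq : 0 ≤ q) (h : q = 0 → p = 0) :
    p - q ≤ p * Real.log (p / q) := by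
  rcases hp.eq_or_lt with rfl | hp'
  · simpa using hq
  have hq' : 0 < q := hq.lt_of_ne' fun h0 => hp'.ne' (h h0)
  have h1 := Real.log_le_sub_one_of_pos (div_pos hq' hp')
  rw [← inv_div, Real.log_inv]
  have h2 := mul_le_mul_of_nonneg_left h1 hp
  have h3 : p * (q / p - 1) = q - p := by field_simp
  linarith

/-- Gibbs' inequality. -/
lemma sum_sub_sum_le_sum_mul_log_div {ι : Type*} [Fintype ι] {p q : ι → ℝ} (hp : ∀ i, 0 ≤ p i)
    (hq : ∀ i, 0 ≤ q i) (h : ∀ i, q i = 0 → p i = 0) :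
    ∑ i, p i - ∑ i, q i ≤ ∑ i, p i * Real.log (p i / q i) := by
  rw [← sum_sub_distrib]
  exact sum_le_sum fun i _ => sub_le_mul_log_div (hp i) (hq i) (h i)

/-! ### Mutual information as a divergence, and Fano's inequality. -/

section MutualInfo

variable {υ β : Type*} [Fintype υ] [Fintype β]

lemma mutualInfo_mul_log_two (P : υ → β → ℝ) :
    mutualInfo P * Real.log 2 =
      ∑ u, ∑ y, P u y * Real.log (P u y / ((∑ y', P u y') * ∑ u', P u' y)) := by
  have h2 : Real.log 2 ≠ 0 := (Real.log_pos one_lt_two).ne'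
  simp only [mutualInfo, sum_mul, Real.logb, mul_assoc]
  refine sum_congr rfl fun u _ => sum_congr rfl fun y _ => ?_
  rw [div_mul_cancel₀ _ h2]

lemma mutualInfo_nonneg {P : υ → β → ℝ} (hP : ∀ u y, 0 ≤ P u y) (h1 : ∑ u, ∑ y, P u y = 1) :
    0 ≤ mutualInfo P := by
  have h := sum_sub_sum_le_sum_mul_log_div (ι := υ × β) (p := fun i => P i.1 i.2)
    (q := fun i => (∑ y', P i.1 y') * ∑ u', P u' i.2) (fun i => hP _ _)
    (fun i => mul_nonneg (sum_nonneg fun _ _ => hP _ _) (sum_nonneg fun _ _ => hP _ _))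
    (fun i hi => by
      rcases mul_eq_zero.1 hi with h0 | h0
      · exact (sum_eq_zero_iff_of_nonneg fun _ _ => hP _ _).1 h0 _ (mem_univ _)
      · exact (sum_eq_zero_iff_of_nonneg fun _ _ => hP _ _).1 h0 _ (mem_univ _))
  simp only [Fintype.sum_prod_type] at h
  rw [← mutualInfo_mul_log_two, h1] at h
  have h2 : ∑ u, ∑ y, (∑ y', P u y') * ∑ u', P u' y = 1 := by
    simp_rw [← mul_sum]
    rw [← sum_mul, h1, sum_comm, h1, one_mul]
  rw [h2, sub_self] at h
  exact nonneg_of_mul_nonneg_left h (Real.log_pos one_lt_two)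

/-- Replacing the output marginal by another distribution increases the divergence. -/
lemma mutualInfo_mul_log_two_le {P : υ → β → ℝ} {Q : β → ℝ} (hP : ∀ u y, 0 ≤ P u y)
    (hQ : ∀ y, 0 ≤ Q y) (hac : ∀ u y, Q y = 0 → P u y = 0) (h1 : ∑ y, Q y ≤ ∑ u, ∑ y, P u y) :
    mutualInfo P * Real.log 2 ≤
      ∑ u, ∑ y, P u y * Real.log (P u y / ((∑ y', P u y') * Q y)) := by
  -- The excess over the mutual information is the divergence of the true output marginal from `Q`,
  -- which Gibbs' inequality makes nonnegative.
  have key : ∑ u, ∑ y, P u y * Real.log (P u y / ((∑ y', P u y') * Q y)) =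
      mutualInfo P * Real.log 2 +
        ∑ y, (∑ u, P u y) * Real.log ((∑ u, P u y) / Q y) := by
    have h2 : ∑ y, (∑ u, P u y) * Real.log ((∑ u, P u y) / Q y) =
        ∑ u, ∑ y, P u y * Real.log ((∑ u, P u y) / Q y) := by
      rw [sum_comm]
      exact sum_congr rfl fun y _ => sum_mul ..
    rw [mutualInfo_mul_log_two, h2, ← sum_add_distrib]
    refine sum_congr rfl fun u _ => ?_
    rw [← sum_add_distrib]
    refine sum_congr rfl fun y _ => ?_
    rcases (hP u y).eq_or_lt with h0 | h0
    · simp [← h0]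
    have hU : 0 < ∑ y', P u y' :=
      h0.trans_le (single_le_sum (f := P u) (fun _ _ => hP _ _) (mem_univ y))
    have hY : 0 < ∑ u', P u' y :=
      h0.trans_le (single_le_sum (f := fun u' => P u' y) (fun _ _ => hP _ _) (mem_univ u))
    have hq : 0 < Q y := (hQ y).lt_of_ne' fun h => h0.ne' (hac u y h)
    rw [← mul_add, ← Real.log_mul (by positivity) (by positivity)]
    congr 2
    field_simp
  have hG := sum_sub_sum_le_sum_mul_log_div (p := fun y => ∑ u, P u y) (q := Q)
    (fun y => sum_nonneg fun _ _ => hP _ _) hQ (fun y hy => sum_eq_zero fun u _ => hac u y hy)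
  rw [sum_comm] at hG
  linarith

lemma mutualInfo_comp_equiv {υ' β' : Type*} [Fintype υ'] [Fintype β'] (e : υ' ≃ υ) (f : β' ≃ β)
    (P : υ → β → ℝ) : mutualInfo (fun u y => P (e u) (f y)) = mutualInfo P := by
  unfold mutualInfo
  rw [← e.sum_comp]
  refine sum_congr rfl fun u _ => ?_
  rw [← f.sum_comp]
  refine sum_congr rfl fun y _ => ?_
  rw [f.sum_comp (fun y => P (e u) y), e.sum_comp (fun u => P u (f y))]

/-- An independent additional output does not change the mutual information. -/
lemma mutualInfo_prod_indep {γ : Type*} [Fintype γ] (v : γ → ℝ) (hv1 : ∑ c, v c = 1)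
    (P : υ → β → ℝ) :
    mutualInfo (fun u (x : γ × β) => P u x.2 * v x.1) = mutualInfo P := by
  unfold mutualInfo
  refine sum_congr rfl fun u _ => ?_
  simp only [Fintype.sum_prod_type, ← sum_mul, ← mul_sum, hv1, mul_one]
  rw [sum_comm]
  refine sum_congr rfl fun y _ => ?_
  calc ∑ c, P u y * v c * Real.logb 2 (P u y * v c / ((∑ y', P u y') * ((∑ u', P u' y) * v c)))
      = ∑ c, (P u y * Real.logb 2 (P u y / ((∑ y', P u y') * ∑ u', P u' y))) * v c := by
        refine sum_congr rfl fun c _ => ?_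
        by_cases hc : v c = 0
        · simp [hc]
        rw [← mul_assoc (∑ y', P u y'), mul_div_mul_right _ _ hc]
        ring
    _ = _ := by rw [← mul_sum, hv1, mul_one]

/-- Fano's inequality for a uniformly distributed message and disjoint decoding sets. -/
lemma fano {J : ℕ} (hJ : 0 < J) {K : Fin J → β → ℝ} (hK : ∀ j y, 0 ≤ K j y)
    (hK1 : ∀ j, ∑ y, K j y = 1) [DecidableEq β] (D : Fin J → Finset β)
    (hD : ∀ i j, i ≠ j → Disjoint (D i) (D j)) {ε : ℝ}
    (hε : ∀ j, ∑ y ∈ (D j)ᶜ, K j y ≤ ε) :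
    (1 - ε) * Real.logb 2 J - 1 ≤ mutualInfo (fun j y => 1 / (J : ℝ) * K j y) := by
  set P : Fin J → β → ℝ := fun j y => 1 / (J : ℝ) * K j y with hPdef
  have hJ' : (0 : ℝ) < J := Nat.cast_pos.2 hJ
  have hP : ∀ j y, 0 ≤ P j y := fun j y => mul_nonneg (by positivity) (hK j y)
  have hPU : ∀ j, ∑ y, P j y = 1 / J := fun j => by rw [← mul_sum, hK1, mul_one]
  have hP1 : ∑ j, ∑ y, P j y = 1 := by simp [hPU, hJ'.ne']
  -- Fano follows from Gibbs' inequality with a reference weight tilted towards correct decoding: `q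
  -- y / 2` on pairs with `y ∈ D j` and `q y / (2 J)` elsewhere. Disjointness of the `D j` keeps its
  -- mass at most one, and the halving costs the one bit in the statement.
  let g : Fin J → β → ℝ := fun j y => if y ∈ D j then (J : ℝ) else 1
  have hg : ∀ j y, 0 < g j y := fun j y => by dsimp only [g]; split_ifs <;> positivity
  set q : β → ℝ := fun y => ∑ j, P j y with hq
  have hq0 : ∀ y, 0 ≤ q y := fun y => sum_nonneg fun _ _ => hP _ _
  have hq1 : ∑ y, q y = 1 := by rw [hq, sum_comm, hP1]
  have hPq : ∀ j y, q y = 0 → P j y = 0 := fun j y h =>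
    (sum_eq_zero_iff_of_nonneg fun _ _ => hP _ _).1 h j (mem_univ _)
  have hG := sum_sub_sum_le_sum_mul_log_div (ι := Fin J × β) (p := fun i => P i.1 i.2)
    (q := fun i => (1 / (J : ℝ)) * q i.2 * (g i.1 i.2 / 2)) (fun i => hP _ _)
    (fun i => mul_nonneg (mul_nonneg (by positivity) (hq0 _)) (by have := hg i.1 i.2; positivity))
    (fun i hi => hPq _ _ (by
      have h1 := (hg i.1 i.2).ne'
      have h2 := hJ'.ne'
      simpa [h1, hJ.ne'] using hi))
  simp only [Fintype.sum_prod_type, hP1] at hG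
  have hmass : ∑ j, ∑ y, 1 / (J : ℝ) * q y * (g j y / 2) ≤ 1 := by
    have h1 : ∀ j y, 1 / (J : ℝ) * q y * (g j y / 2) ≤
        1 / (J : ℝ) * q y / 2 + (if y ∈ D j then q y else 0) / 2 := fun j y => by
      have h0 : 0 ≤ 1 / (J : ℝ) * q y := mul_nonneg (by positivity) (hq0 y)
      dsimp only [g]
      split_ifs with h
      · have : 1 / (J : ℝ) * q y * (J / 2) = q y / 2 := by field_simp
        rw [this]; linarith
      · linarith
    have h2 : ∑ j, ∑ y, (if y ∈ D j then q y else 0) ≤ 1 := by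
      have h3 : ∀ j, ∑ y, (if y ∈ D j then q y else 0) = ∑ y ∈ D j, q y := fun j => by
        rw [← sum_filter, filter_mem_eq_inter, univ_inter]
      simp_rw [h3]
      rw [← sum_biUnion (fun i _ j _ hij => hD i j hij), ← hq1]
      exact sum_le_sum_of_subset_of_nonneg (subset_univ _) fun y _ _ => hq0 y
    calc _ ≤ ∑ j, ∑ y, (1 / (J : ℝ) * q y / 2 + (if y ∈ D j then q y else 0) / 2) :=
          sum_le_sum fun j _ => sum_le_sum fun y _ => h1 j y
      _ = (∑ j : Fin J, ∑ y, 1 / (J : ℝ) * q y) / 2 +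
          (∑ j, ∑ y, (if y ∈ D j then q y else 0)) / 2 := by
          simp only [sum_add_distrib, sum_div]
      _ ≤ 1 := by
          have : ∑ j : Fin J, ∑ y, 1 / (J : ℝ) * q y = 1 := by
            simp_rw [← mul_sum, hq1]; simp [hJ'.ne']
          rw [this]; linarith
  have hlog : ∑ j, ∑ y, P j y * Real.log (P j y / (1 / (J : ℝ) * q y * (g j y / 2))) =
      mutualInfo P * Real.log 2 + Real.log 2 -
        (∑ j, ∑ y, if y ∈ D j then P j y else 0) * Real.log J := by
    have h2 : Real.log 2 = ∑ j, ∑ y, P j y * Real.log 2 := by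
      simp_rw [← sum_mul, hP1, one_mul]
    have h3 : (∑ j, ∑ y, if y ∈ D j then P j y else 0) * Real.log J =
        ∑ j, ∑ y, (if y ∈ D j then P j y else 0) * Real.log J := by
      simp_rw [sum_mul]
    have h4 : ∀ y, ∑ j, P j y = q y := fun _ => rfl
    rw [mutualInfo_mul_log_two, h2, h3]
    simp_rw [hPU, h4, ← sum_add_distrib, ← sum_sub_distrib]
    refine sum_congr rfl fun j _ => sum_congr rfl fun y _ => ?_
    rcases (hP j y).eq_or_lt with h0 | h0
    · simp [← h0]
    have hqy : 0 < q y := (hq0 y).lt_of_ne' fun h => h0.ne' (hPq j y h)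
    have hgy := hg j y
    rw [show P j y / (1 / (J : ℝ) * q y * (g j y / 2)) =
      P j y / (1 / (J : ℝ) * q y) * 2 / g j y by field_simp,
      Real.log_div (by positivity) hgy.ne', Real.log_mul (by positivity) two_ne_zero]
    dsimp only [g]
    split_ifs
    · ring
    · simp; ring
  have hcor : (1 - ε) ≤ ∑ j, ∑ y, if y ∈ D j then P j y else 0 := by
    have h1 : ∀ j, (1 / (J : ℝ)) * (1 - ε) ≤ ∑ y, if y ∈ D j then P j y else 0 := fun j => by
      rw [← sum_filter, filter_mem_eq_inter, univ_inter, ← mul_sum]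
      have := sum_add_sum_compl (D j) (K j)
      rw [hK1] at this
      have h2 := hε j
      exact mul_le_mul_of_nonneg_left (by linarith) (by positivity)
    calc 1 - ε = ∑ j : Fin J, (1 / (J : ℝ)) * (1 - ε) := by simp [hJ'.ne']
      _ ≤ _ := sum_le_sum fun j _ => h1 j
  have hlogJ : 0 ≤ Real.log J := Real.log_nonneg (by exact_mod_cast hJ)
  have h2 : 0 < Real.log 2 := Real.log_pos one_lt_two
  have hc := mul_le_mul_of_nonneg_right hcor hlogJ
  rw [hlog] at hG
  have : ((1 - ε) * Real.logb 2 J - 1) * Real.log 2 ≤ mutualInfo P * Real.log 2 := by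
    have h3 : ((1 - ε) * Real.logb 2 J - 1) * Real.log 2 = (1 - ε) * Real.log J - Real.log 2 := by
      rw [Real.logb]; field_simp
    linarith
  exact le_of_mul_le_mul_right this h2

end MutualInfo

/-! ### Expectations over random codebooks: resolvability, threshold tests, expurgation. -/

section RandomCoding

variable {ι S : Type*} [Fintype ι] [DecidableEq ι] [Fintype S]

/-- Expectation over an i.i.d. family of a product of functions of two distinct members. -/
lemma sum_iid_mul_mul {p : S → ℝ} (hp1 : ∑ s, p s = 1) {i i' : ι} (hi : i ≠ i') (g h : S → ℝ) :
    ∑ f : ι → S, (∏ k, p (f k)) * (g (f i) * h (f i')) =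
      (∑ s, p s * g s) * ∑ s, p s * h s := by
  classical
  have h1 : ∀ f : ι → S, (∏ k, p (f k)) * (g (f i) * h (f i')) =
      ∏ k, (p (f k) * ((if k = i then g (f k) else 1) * if k = i' then h (f k) else 1)) :=
    fun f => by rw [prod_mul_distrib, prod_mul_distrib]; simp
  simp_rw [h1]
  rw [← Fintype.prod_sum
    (fun k s => p s * ((if k = i then g s else 1) * if k = i' then h s else 1))]
  have h2 : ∀ k, ∑ s, p s * ((if k = i then g s else 1) * if k = i' then h s else 1) =
      (if k = i then ∑ s, p s * g s else 1) * if k = i' then ∑ s, p s * h s else 1 := fun k => by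
    by_cases h3 : k = i
    · subst h3; simp [hi]
    · by_cases h4 : k = i' <;> simp [h3, h4, hp1, hi.symm]
  simp_rw [h2]
  rw [prod_mul_distrib]
  simp

lemma sum_iid_mul {p : S → ℝ} (hp1 : ∑ s, p s = 1) (i : ι) (g : S → ℝ) :
    ∑ f : ι → S, (∏ k, p (f k)) * g (f i) = ∑ s, p s * g s := by
  classical
  have h1 : ∀ f : ι → S, (∏ k, p (f k)) * g (f i) =
      ∏ k, (p (f k) * (if k = i then g (f k) else 1)) :=
    fun f => by rw [prod_mul_distrib]; simp
  simp_rw [h1]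
  rw [← Fintype.prod_sum (fun k s => p s * (if k = i then g s else 1))]
  have h2 : ∀ k, ∑ s, p s * (if k = i then g s else 1) =
      (if k = i then ∑ s, p s * g s else 1) := fun k => by
    by_cases h3 : k = i <;> simp [h3, hp1]
  simp_rw [h2]
  simp

lemma sum_iid {p : S → ℝ} (hp1 : ∑ s, p s = 1) : ∑ f : ι → S, (∏ k, p (f k)) = 1 := by
  rw [← Fintype.prod_sum (fun _ s => p s)]
  simp [hp1]

/-- Single-output form of the divergence bound for channel resolvability. -/
lemma sum_iid_resolvability_le {p : S → ℝ} (hp : ∀ s, 0 ≤ p s) (hp1 : ∑ s, p s = 1)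
    {κ : Type*} [Fintype κ] [DecidableEq κ] [Nonempty κ] {a : κ → ι} (ha : Function.Injective a)
    {v : S → ℝ} (hv : ∀ s, 0 ≤ v s) :
    ∑ f : ι → S, (∏ k, p (f k)) * ((1 / (Fintype.card κ : ℝ) * ∑ l, v (f (a l))) *
        Real.log ((1 / (Fintype.card κ : ℝ) * ∑ l, v (f (a l))) / ∑ s, p s * v s)) ≤
      ∑ s, p s * (v s * Real.log (1 + v s / (Fintype.card κ * ∑ s, p s * v s))) := by
  set L : ℝ := (Fintype.card κ : ℝ) with hL
  have hLpos : 0 < L := Nat.cast_pos.2 Fintype.card_pos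
  set Q : ℝ := ∑ s, p s * v s with hQ
  have hQ0 : 0 ≤ Q := sum_nonneg fun s _ => mul_nonneg (hp s) (hv s)
  rcases hQ0.eq_or_lt with hQz | hQpos
  · simp [← hQz]
  have hμ : ∀ f : ι → S, 0 ≤ ∏ k, p (f k) := fun f => prod_nonneg fun _ _ => hp _
  set x : S → ℝ := fun s => v s / (L * Q) with hx
  have hx0 : ∀ s, 0 ≤ x s := fun s => by have := hv s; positivity
  have hxsum : ∑ s, p s * x s = 1 / L := by
    simp_rw [hx, ← mul_div_assoc]
    rw [← sum_div, ← hQ]; field_simp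
  -- tangent line of the logarithm at `1 + x (f (a l))`
  have htan : ∀ f : ι → S, ∀ l, v (f (a l)) *
      Real.log ((1 / L * ∑ l, v (f (a l))) / Q) ≤
      v (f (a l)) * (Real.log (1 + x (f (a l))) - 1) +
        v (f (a l)) / (1 + x (f (a l))) * ∑ l', x (f (a l')) := fun f l => by
    rcases (hv (f (a l))).eq_or_lt with h0 | h0
    · simp [← h0]
    have hsum : (1 / L * ∑ l, v (f (a l))) / Q = ∑ l', x (f (a l')) := by
      simp only [hx]
      rw [← sum_div]; field_simp
    have hspos : 0 < ∑ l', x (f (a l')) :=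
      lt_of_lt_of_le (by simp only [hx]; positivity)
        (single_le_sum (f := fun l' => x (f (a l'))) (fun _ _ => hx0 _) (mem_univ l))
    rw [hsum]
    have ha1 : 0 < 1 + x (f (a l)) := by have := hx0 (f (a l)); linarith
    have := Real.log_le_sub_one_of_pos (div_pos hspos ha1)
    rw [Real.log_div hspos.ne' ha1.ne'] at this
    calc _ ≤ v (f (a l)) * (Real.log (1 + x (f (a l))) - 1 +
          (∑ l', x (f (a l'))) / (1 + x (f (a l)))) := by gcongr; linarith
      _ = _ := by ring
  -- expectation of the tangent line
  have hexp : ∀ l, ∑ f : ι → S, (∏ k, p (f k)) *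
      (v (f (a l)) * (Real.log (1 + x (f (a l))) - 1) +
        v (f (a l)) / (1 + x (f (a l))) * ∑ l', x (f (a l'))) ≤
      ∑ s, p s * (v s * Real.log (1 + x s)) := fun l => by
    have e1 : ∀ f : ι → S, (∏ k, p (f k)) *
        (v (f (a l)) * (Real.log (1 + x (f (a l))) - 1) +
          v (f (a l)) / (1 + x (f (a l))) * ∑ l', x (f (a l'))) =
        (∏ k, p (f k)) * (v (f (a l)) * (Real.log (1 + x (f (a l))) - 1) +
          v (f (a l)) / (1 + x (f (a l))) * x (f (a l))) +
        ∑ l' ∈ univ.erase l, (∏ k, p (f k)) *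
          (v (f (a l)) / (1 + x (f (a l))) * x (f (a l'))) := fun f => by
      rw [← add_sum_erase univ _ (mem_univ l), ← mul_sum, ← mul_sum]; ring
    simp_rw [e1]
    rw [sum_add_distrib, sum_comm, sum_iid_mul hp1 (a l)
      (fun s => v s * (Real.log (1 + x s) - 1) + v s / (1 + x s) * x s)]
    have e2 : ∀ l' ∈ univ.erase l, ∑ f : ι → S, (∏ k, p (f k)) *
        (v (f (a l)) / (1 + x (f (a l))) * x (f (a l'))) =
        (∑ s, p s * (v s / (1 + x s))) * (1 / L) := fun l' hl' => by
      rw [sum_iid_mul_mul hp1 (fun h => (ne_of_mem_erase hl') (ha h).symm)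
        (fun s => v s / (1 + x s)) x, hxsum]
    rw [sum_congr rfl e2, sum_const, card_erase_of_mem (mem_univ l), card_univ, nsmul_eq_mul,
      Nat.cast_sub Fintype.card_pos, ← hL, Nat.cast_one]
    have e3 : ∑ s, p s * (v s * (Real.log (1 + x s) - 1) + v s / (1 + x s) * x s) =
        ∑ s, p s * (v s * Real.log (1 + x s)) - ∑ s, p s * (v s / (1 + x s)) := by
      rw [← sum_sub_distrib]
      refine sum_congr rfl fun s _ => ?_
      have : 1 + x s ≠ 0 := by have := hx0 s; positivity
      field_simp
      ring
    rw [e3]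
    have e4 : 0 ≤ ∑ s, p s * (v s / (1 + x s)) := sum_nonneg fun s _ => by
      have h1 := hx0 s; have h2 := hp s; have h3 := hv s; positivity
    -- The `L - 1` cross terms, each carrying a factor `1 / L` by independence, are absorbed by the
    -- negative term that `e3` extracts from the diagonal.
    have e5 : (L - 1) * ((∑ s, p s * (v s / (1 + x s))) * (1 / L)) ≤
        ∑ s, p s * (v s / (1 + x s)) := by
      have : (L - 1) * ((∑ s, p s * (v s / (1 + x s))) * (1 / L)) =
        (∑ s, p s * (v s / (1 + x s))) - (∑ s, p s * (v s / (1 + x s))) / L := by field_simp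
      rw [this]
      have : 0 ≤ (∑ s, p s * (v s / (1 + x s))) / L := by positivity
      linarith
    linarith
  calc _ = 1 / L * ∑ l, ∑ f : ι → S, (∏ k, p (f k)) * (v (f (a l)) *
        Real.log ((1 / L * ∑ l, v (f (a l))) / Q)) := by
        rw [sum_comm, mul_sum]
        refine sum_congr rfl fun f _ => ?_
        rw [← mul_sum, ← sum_mul]; ring
    _ ≤ 1 / L * ∑ l : κ, ∑ s, p s * (v s * Real.log (1 + x s)) := by
        refine mul_le_mul_of_nonneg_left (sum_le_sum fun l _ => le_trans ?_ (hexp l))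
          (by positivity)
        exact sum_le_sum fun f _ => mul_le_mul_of_nonneg_left (htan f l) (hμ f)
    _ = _ := by
        rw [sum_const, card_univ, nsmul_eq_mul, ← hL, ← mul_assoc, one_div_mul_cancel hLpos.ne',
          one_mul]

/-- The probability that an independent input passes a threshold test. -/
lemma sum_threshold_le {p : S → ℝ} (hp : ∀ s, 0 ≤ p s) {w : S → ℝ} (hw : ∀ s, 0 ≤ w s)
    {Γ : ℝ} (hΓ : 0 < Γ) :
    ∑ s, p s * (open Classical in if Γ * ∑ s, p s * w s < w s then 1 else 0) ≤ 1 / Γ := by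
  set q := ∑ s, p s * w s with hq
  have hq0 : 0 ≤ q := sum_nonneg fun s _ => mul_nonneg (hp s) (hw s)
  rcases hq0.eq_or_lt with h0 | h0
  · rw [sum_eq_zero]
    · positivity
    intro s _
    have h1 : p s * w s = 0 :=
      (sum_eq_zero_iff_of_nonneg fun s _ => mul_nonneg (hp s) (hw s)).1 (hq ▸ h0.symm) s
        (mem_univ _)
    rcases mul_eq_zero.1 h1 with h2 | h2
    · simp [h2]
    · simp [h2, ← h0]
  -- Markov's inequality: the indicator is at most `w s / (Γ q)`, whose mean is `1 / Γ`.
  · calc _ ≤ ∑ s, p s * (w s / (Γ * q)) := by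
          refine sum_le_sum fun s _ => mul_le_mul_of_nonneg_left ?_ (hp s)
          have := hw s
          split_ifs with h
          · rw [one_le_div (by positivity)]; exact h.le
          · positivity
      _ = 1 / Γ := by
          simp_rw [← mul_div_assoc]
          rw [← sum_div, ← hq]; field_simp

/-- At least half of the members of a family have at most twice the average cost. -/
lemma exists_embedding_le_two_mul {J : ℕ} {c : Fin (2 * J) → ℝ} (hc : ∀ j, 0 ≤ c j) {δ : ℝ}
    (hδ : 0 ≤ δ) (h : ∑ j, c j ≤ 2 * J * δ) :
    ∃ e : Fin J ↪ Fin (2 * J), ∀ j, c (e j) ≤ 2 * δ := by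
  classical
  suffices hcard : Fintype.card (Fin J) ≤ Fintype.card {j // c j ≤ 2 * δ} by
    obtain ⟨e⟩ := Function.Embedding.nonempty_of_card_le hcard
    exact ⟨e.trans (Function.Embedding.subtype _), fun j => (e j).2⟩
  rw [Fintype.card_fin, Fintype.card_subtype]
  by_contra! hlt
  have h1 := card_filter_add_card_filter_not (s := (univ : Finset (Fin (2 * J))))
    (fun j => c j ≤ 2 * δ)
  rw [card_univ, Fintype.card_fin] at h1
  have h2 : J + 1 ≤ #{j | ¬ c j ≤ 2 * δ} := by omega
  have hne : ({j | ¬ c j ≤ 2 * δ} : Finset (Fin (2 * J))).Nonempty := card_pos.1 (by omega)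
  -- Strictness here settles the case `δ = 0` as well.
  have h3 : ∑ j ∈ {j | ¬ c j ≤ 2 * δ}, (2 * δ) < ∑ j ∈ {j | ¬ c j ≤ 2 * δ}, c j :=
    sum_lt_sum_of_nonempty hne fun j hj => not_le.1 (mem_filter.1 hj).2
  have h4 : ∑ j ∈ {j | ¬ c j ≤ 2 * δ}, c j ≤ ∑ j, c j :=
    sum_le_sum_of_subset_of_nonneg (subset_univ _) fun _ _ _ => hc _
  rw [sum_const, nsmul_eq_mul] at h3
  have h5 : ((J : ℝ) + 1) ≤ #{j | ¬ c j ≤ 2 * δ} := by exact_mod_cast h2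
  nlinarith

/-- A plain averaging argument could select a codebook of weight zero. Requiring positive weight of
each codeword keeps every output law absolutely continuous with respect to the random coding output,
as the divergence estimates need. -/
lemma exists_pos_weight_le {p : S → ℝ} (hp : ∀ s, 0 ≤ p s) (hp1 : ∑ s, p s = 1)
    {F : (ι → S) → ℝ} {δ : ℝ} (h : ∑ f : ι → S, (∏ k, p (f k)) * F f ≤ δ) :
    ∃ f : ι → S, (∀ k, 0 < p (f k)) ∧ F f ≤ δ := by
  by_contra! hcon
  have h0 : ∑ f : ι → S, (∏ k, p (f k)) * δ = δ := by rw [← sum_mul, sum_iid hp1, one_mul]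
  have hle : ∀ f : ι → S, (∏ k, p (f k)) * δ ≤ (∏ k, p (f k)) * F f := fun f => by
    by_cases hf : ∀ k, 0 < p (f k)
    · exact mul_le_mul_of_nonneg_left (hcon f hf).le (prod_nonneg fun _ _ => hp _)
    · push Not at hf
      obtain ⟨k, hk⟩ := hf
      rw [prod_eq_zero (mem_univ k) (le_antisymm hk (hp _))]; simp
  obtain ⟨s, hs⟩ : ∃ s, 0 < p s := by
    by_contra! hs
    have : ∑ s, p s ≤ 0 := sum_nonpos fun s _ => hs s
    linarith
  have : ∑ f : ι → S, (∏ k, p (f k)) * δ < ∑ f : ι → S, (∏ k, p (f k)) * F f :=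
    sum_lt_sum (fun f _ => hle f) ⟨fun _ => s, mem_univ _,
      mul_lt_mul_of_pos_left (hcon _ fun _ => hs) (prod_pos fun _ _ => hs)⟩
  linarith

end RandomCoding

/-! ### The decoder that tests all channel states at once. -/

section ThresholdDecoder

variable {θ S Y κ l : Type*} [Fintype Y] [Fintype l]

/-- The threshold decoder: message `j` is decoded if some codeword for `j` passes one of the tests
`T t` and no codeword for another message does. -/
noncomputable def thresholdDec (T : θ → S → Y → Prop) (f : κ × l → S) (j : κ) : Finset Y :=
  open Classical in
  {y | (∃ i t, T t (f (j, i)) y) ∧ ∀ j', j' ≠ j → ∀ i t, ¬ T t (f (j', i)) y}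

lemma thresholdDec_disjoint (T : θ → S → Y → Prop) (f : κ × l → S) {j j' : κ} (h : j ≠ j') :
    Disjoint (thresholdDec T f j) (thresholdDec T f j') := by
  classical
  rw [Finset.disjoint_left]
  intro y hy hy'
  simp only [thresholdDec, mem_filter, mem_univ, true_and] at hy hy'
  obtain ⟨⟨i, t, hT⟩, -⟩ := hy
  exact hy'.2 j h i t hT

/-- Union bound: a decoding error means that the transmitted codeword fails the test for the true
state, or that a codeword of another message passes the test for some state. -/
lemma sum_compl_thresholdDec_le [Fintype θ] [Fintype κ] [DecidableEq κ] [DecidableEq Y]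
    (T : θ → S → Y → Prop) (f : κ × l → S) (j : κ) (i : l) (t : θ) {w : Y → ℝ}
    (hw : ∀ y, 0 ≤ w y) :
    open Classical in
    ∑ y ∈ (thresholdDec T f j)ᶜ, w y ≤
      ∑ y, w y * (if T t (f (j, i)) y then 0 else 1) +
        ∑ j' ∈ univ.erase j, ∑ i', ∑ t', ∑ y, w y * (if T t' (f (j', i')) y then 1 else 0) := by
  classical
  have h1 : ∀ y ∈ (thresholdDec T f j)ᶜ, w y ≤ w y * (if T t (f (j, i)) y then 0 else 1) +
      ∑ j' ∈ univ.erase j, ∑ i', ∑ t', w y * (if T t' (f (j', i')) y then 1 else 0) := by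
    intro y hy
    have hn : ∀ j' i' t', 0 ≤ w y * (if T t' (f (j', i')) y then (1 : ℝ) else 0) := fun _ _ _ =>
      mul_nonneg (hw y) (by split_ifs <;> simp)
    by_cases hT : T t (f (j, i)) y
    · have : ∃ j', j' ≠ j ∧ ∃ i' t', T t' (f (j', i')) y := by
        by_contra! hcon
        exact (mem_compl.1 hy) (by
          simp only [thresholdDec, mem_filter, mem_univ, true_and]
          exact ⟨⟨i, t, hT⟩, hcon⟩)
      obtain ⟨j', hj', i', t', hT'⟩ := this
      calc w y = w y * (if T t' (f (j', i')) y then 1 else 0) := by simp [hT']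
        _ ≤ ∑ t', w y * (if T t' (f (j', i')) y then 1 else 0) :=
          single_le_sum (f := fun t' => w y * (if T t' (f (j', i')) y then (1 : ℝ) else 0))
            (fun t' _ => hn j' i' t') (mem_univ t')
        _ ≤ ∑ i', ∑ t', w y * (if T t' (f (j', i')) y then 1 else 0) :=
          single_le_sum (f := fun i' => ∑ t', w y * (if T t' (f (j', i')) y then (1 : ℝ) else 0))
            (fun i' _ => sum_nonneg fun t' _ => hn j' i' t') (mem_univ i')
        _ ≤ ∑ j' ∈ univ.erase j, ∑ i', ∑ t', w y * (if T t' (f (j', i')) y then 1 else 0) :=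
          single_le_sum
            (f := fun j' => ∑ i', ∑ t', w y * (if T t' (f (j', i')) y then (1 : ℝ) else 0))
            (fun j' _ => sum_nonneg fun i' _ => sum_nonneg fun t' _ => hn j' i' t')
            (mem_erase.2 ⟨hj', mem_univ _⟩)
        _ = _ := by simp [hT]
    · have := sum_nonneg fun j' (_ : j' ∈ univ.erase j) =>
        sum_nonneg fun i' (_ : i' ∈ univ) => sum_nonneg fun t' (_ : t' ∈ univ) => hn j' i' t'
      simp only [hT, if_false, mul_one]
      linarith
  have hn : ∀ y, 0 ≤ w y * (if T t (f (j, i)) y then 0 else 1) +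
      ∑ j' ∈ univ.erase j, ∑ i', ∑ t', w y * (if T t' (f (j', i')) y then (1 : ℝ) else 0) :=
    fun y => add_nonneg (mul_nonneg (hw y) (by split_ifs <;> simp))
      (sum_nonneg fun _ _ => sum_nonneg fun _ _ => sum_nonneg fun _ _ =>
        mul_nonneg (hw y) (by split_ifs <;> simp))
  calc _ ≤ ∑ y, (w y * (if T t (f (j, i)) y then 0 else 1) +
        ∑ j' ∈ univ.erase j, ∑ i', ∑ t', w y * (if T t' (f (j', i')) y then 1 else 0)) :=
        (sum_le_sum h1).trans (sum_le_sum_of_subset_of_nonneg (subset_univ _) fun y _ _ => hn y)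
    _ = _ := by
        rw [sum_add_distrib, sum_comm]
        congr 1
        refine sum_congr rfl fun j' _ => ?_
        rw [sum_comm]
        refine sum_congr rfl fun i' _ => ?_
        rw [sum_comm]

end ThresholdDecoder

/-! ### One-shot random coding for the compound wiretap channel. -/

section OneShot

variable {θ S Y Z : Type*} [Fintype θ] [Fintype S] [Fintype Y] [DecidableEq Y] [Fintype Z]

/-- The output distribution of a channel for a given input weight. -/
noncomputable def outputDist (p : S → ℝ) (W : Channel S Y) (y : Y) : ℝ := ∑ s, p s * W s y

/-- The probability of missing the threshold test `Γ q(y) < W(y | s)`. -/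
noncomputable def missProb (p : S → ℝ) (W : Channel S Y) (Γ : ℝ) : ℝ :=
  ∑ s, p s * ∑ y, W s y *
    (open Classical in if Γ * outputDist p W y < W s y then 0 else 1)

/-- The divergence bound for the resolvability of the output of `V` with `L` codewords. -/
noncomputable def resolvBound (p : S → ℝ) (V : Channel S Z) (L : ℕ) : ℝ :=
  ∑ s, p s * ∑ z, V s z * Real.log (1 + V s z / (L * outputDist p V z))

lemma outputDist_nonneg {p : S → ℝ} (hp : ∀ s, 0 ≤ p s) (V : Channel S Z) (z : Z) :
    0 ≤ outputDist p V z :=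
  sum_nonneg fun s _ => mul_nonneg (hp s) ((V s).2.1 z)

lemma sum_outputDist {p : S → ℝ} (hp1 : ∑ s, p s = 1) (V : Channel S Z) :
    ∑ z, outputDist p V z = 1 := by
  simp only [outputDist]
  rw [sum_comm]
  simp_rw [← mul_sum]
  rw [← hp1]
  exact sum_congr rfl fun s _ => by rw [show ∑ y, V s y = 1 from (V s).2.2, mul_one]

/-- Expected error probability of the threshold decoder for i.i.d. codewords. -/
lemma sum_iid_error_le {p : S → ℝ} (hp : ∀ s, 0 ≤ p s) (hp1 : ∑ s, p s = 1)
    (W : θ → Channel S Y) {Γ : ℝ} (hΓ : 0 < Γ) {J L : ℕ} (j : Fin J) (i : Fin L) (t : θ) :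
    ∑ f : Fin J × Fin L → S, (∏ k, p (f k)) *
        ∑ y ∈ (thresholdDec (fun t s y => Γ * outputDist p (W t) y < W t s y) f j)ᶜ,
          W t (f (j, i)) y ≤
      missProb p (W t) Γ + Fintype.card θ * (J * L) / Γ := by
  classical
  set T : θ → S → Y → Prop := fun t s y => Γ * outputDist p (W t) y < W t s y with hT
  have hμ : ∀ f : Fin J × Fin L → S, 0 ≤ ∏ k, p (f k) := fun f => prod_nonneg fun _ _ => hp _
  have hfirst : ∑ f : Fin J × Fin L → S, (∏ k, p (f k)) *
      ∑ y, W t (f (j, i)) y * (if T t (f (j, i)) y then 0 else 1) = missProb p (W t) Γ := by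
    rw [sum_iid_mul hp1 (j, i) (fun s => ∑ y, W t s y * (if T t s y then 0 else 1)), missProb]
  -- The competing codeword is independent of the output, and the threshold estimate holds for each
  -- fixed `y`. Hence it is harmless that `y` is produced in state `t` while the test is calibrated
  -- to state `t'`.
  have hsecond : ∀ j' ∈ univ.erase j, ∀ i' t', ∑ f : Fin J × Fin L → S, (∏ k, p (f k)) *
      ∑ y, W t (f (j, i)) y * (if T t' (f (j', i')) y then 1 else 0) ≤ 1 / Γ := by
    intro j' hj' i' t'
    have hne : (j, i) ≠ (j', i') := fun h => (ne_of_mem_erase hj') (congrArg Prod.fst h).symm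
    simp_rw [mul_sum]
    rw [sum_comm]
    calc _ = ∑ y, outputDist p (W t) y * ∑ s, p s * (if T t' s y then 1 else 0) := by
          refine sum_congr rfl fun y _ => ?_
          rw [sum_iid_mul_mul hp1 hne (fun s => W t s y) (fun s => if T t' s y then 1 else 0)]
          rfl
      _ ≤ ∑ y, outputDist p (W t) y * (1 / Γ) := by
          refine sum_le_sum fun y _ => mul_le_mul_of_nonneg_left ?_ (outputDist_nonneg hp _ y)
          have := sum_threshold_le hp (w := fun s => W t' s y) (fun s => (W t' s).2.1 y) hΓ
          exact le_trans (le_of_eq (sum_congr rfl fun s _ =>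
            congrArg _ (if_congr Iff.rfl rfl rfl))) this
      _ = 1 / Γ := by rw [← sum_mul, sum_outputDist hp1, one_mul]
  have hsum : ∑ j' ∈ univ.erase j, ∑ i' : Fin L, ∑ t' : θ, ∑ f : Fin J × Fin L → S,
      (∏ k, p (f k)) * ∑ y, W t (f (j, i)) y * (if T t' (f (j', i')) y then 1 else 0) ≤
      Fintype.card θ * (J * L) / Γ := by
    calc _ ≤ ∑ j' ∈ univ.erase j, ∑ i' : Fin L, ∑ t' : θ, 1 / Γ :=
          sum_le_sum fun j' hj' => sum_le_sum fun i' _ => sum_le_sum fun t' _ =>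
            hsecond j' hj' i' t'
      _ ≤ ∑ j' : Fin J, ∑ i' : Fin L, ∑ t' : θ, 1 / Γ :=
          sum_le_sum_of_subset_of_nonneg (subset_univ _) fun _ _ _ => by positivity
      _ = _ := by simp; ring
  calc _ ≤ ∑ f : Fin J × Fin L → S, (∏ k, p (f k)) *
        (∑ y, W t (f (j, i)) y * (if T t (f (j, i)) y then 0 else 1) +
        ∑ j' ∈ univ.erase j, ∑ i', ∑ t', ∑ y,
          W t (f (j, i)) y * (if T t' (f (j', i')) y then 1 else 0)) := by
        refine sum_le_sum fun f _ => mul_le_mul_of_nonneg_left ?_ (hμ f)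
        have := sum_compl_thresholdDec_le T f j i t (w := fun y => W t (f (j, i)) y)
          (fun y => (W t _).2.1 y)
        convert this using 2
    _ = missProb p (W t) Γ + ∑ j' ∈ univ.erase j, ∑ i' : Fin L, ∑ t' : θ,
        ∑ f : Fin J × Fin L → S, (∏ k, p (f k)) *
        ∑ y, W t (f (j, i)) y * (if T t' (f (j', i')) y then 1 else 0) := by
        simp_rw [mul_add]
        rw [sum_add_distrib, hfirst]
        congr 1
        simp_rw [mul_sum (s := univ.erase j)]
        rw [sum_comm]
        refine sum_congr rfl fun j' _ => ?_
        simp_rw [mul_sum (s := (univ : Finset (Fin L)))]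
        rw [sum_comm]
        refine sum_congr rfl fun i' _ => ?_
        simp_rw [mul_sum (s := (univ : Finset θ))]
        rw [sum_comm]
    _ ≤ _ := by linarith

/-- One-shot random coding for a compound wiretap channel: a codebook all of whose messages have
small error probability and output close in divergence to the random coding output. -/
theorem exists_codebook {p : S → ℝ} (hp : ∀ s, 0 ≤ p s) (hp1 : ∑ s, p s = 1)
    (W : θ → Channel S Y) (V : θ → Channel S Z) {Γ : ℝ} (hΓ : 0 < Γ) {J L : ℕ} (hL : 0 < L)
    {δ : ℝ} (hδ0 : 0 ≤ δ)
    (hδ : ∑ t, (missProb p (W t) Γ + Fintype.card θ * (2 * J * L) / Γ) +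
      ∑ t, resolvBound p (V t) L ≤ δ) :
    ∃ (u : Fin J → Fin L → S) (D : Fin J → Finset Y),
      (∀ i j, i ≠ j → Disjoint (D i) (D j)) ∧
      (∀ t j, 1 / (L : ℝ) * ∑ l, ∑ y ∈ (D j)ᶜ, W t (u j l) y ≤ 2 * δ) ∧
      (∀ t j, ∑ z, (1 / (L : ℝ) * ∑ l, V t (u j l) z) *
        Real.log ((1 / (L : ℝ) * ∑ l, V t (u j l) z) / outputDist p (V t) z) ≤ 2 * δ) ∧
      ∀ j l, 0 < p (u j l) := by
  classical
  have hLpos : (0 : ℝ) < L := Nat.cast_pos.2 hL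
  have : Nonempty (Fin L) := ⟨⟨0, hL⟩⟩
  let D (f : Fin (2 * J) × Fin L → S) (j : Fin (2 * J)) : Finset Y :=
    thresholdDec (fun t s y => Γ * outputDist p (W t) y < W t s y) f j
  let err (f : Fin (2 * J) × Fin L → S) (t : θ) (j : Fin (2 * J)) : ℝ :=
    1 / (L : ℝ) * ∑ l, ∑ y ∈ (D f j)ᶜ, W t (f (j, l)) y
  let v (f : Fin (2 * J) × Fin L → S) (t : θ) (j : Fin (2 * J)) (z : Z) : ℝ :=
    1 / (L : ℝ) * ∑ l, V t (f (j, l)) z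
  let leak (f : Fin (2 * J) × Fin L → S) (t : θ) (j : Fin (2 * J)) : ℝ :=
    ∑ z, v f t j z * Real.log (v f t j z / outputDist p (V t) z)
  have herr : ∀ t j, ∑ f : Fin (2 * J) × Fin L → S, (∏ k, p (f k)) * err f t j ≤
      missProb p (W t) Γ + Fintype.card θ * (2 * J * L) / Γ := by
    intro t j
    calc _ = 1 / (L : ℝ) * ∑ l, ∑ f : Fin (2 * J) × Fin L → S, (∏ k, p (f k)) *
          ∑ y ∈ (D f j)ᶜ, W t (f (j, l)) y := by
          rw [sum_comm, mul_sum]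
          refine sum_congr rfl fun f _ => ?_
          rw [← mul_sum]
          simp only [err]
          ring
      _ ≤ 1 / (L : ℝ) * ∑ l : Fin L, (missProb p (W t) Γ + Fintype.card θ * (2 * J * L) / Γ) := by
          refine mul_le_mul_of_nonneg_left (sum_le_sum fun l _ => ?_) (by positivity)
          have := sum_iid_error_le hp hp1 W hΓ j l t
          push_cast at this
          exact this
      _ = _ := by
          rw [sum_const, card_univ, Fintype.card_fin, nsmul_eq_mul, ← mul_assoc,
            one_div_mul_cancel hLpos.ne', one_mul]
  have hleak : ∀ t j, ∑ f : Fin (2 * J) × Fin L → S, (∏ k, p (f k)) * leak f t j ≤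
      resolvBound p (V t) L := by
    intro t j
    simp only [leak, resolvBound, mul_sum]
    rw [sum_comm, sum_comm (s := (univ : Finset S))]
    refine sum_le_sum fun z _ => ?_
    have := sum_iid_resolvability_le hp hp1 (κ := Fin L) (a := fun l => (j, l))
      (fun l l' h => (Prod.mk.inj h).2) (v := fun s => V t s z) (fun s => (V t s).2.1 z)
    simp only [Fintype.card_fin] at this
    exact this
  -- The codebook is drawn with `2 * J` messages so that `J` survive expurgation. Each message is
  -- charged its errors and divergences over all states.
  have hcost : ∑ f : Fin (2 * J) × Fin L → S, (∏ k, p (f k)) *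
      ∑ j, (∑ t, err f t j + ∑ t, leak f t j) ≤ 2 * J * δ := by
    calc _ = ∑ j, (∑ t, ∑ f : Fin (2 * J) × Fin L → S, (∏ k, p (f k)) * err f t j +
          ∑ t, ∑ f : Fin (2 * J) × Fin L → S, (∏ k, p (f k)) * leak f t j) := by
          simp_rw [mul_sum, mul_add, mul_sum]
          rw [sum_comm]
          refine sum_congr rfl fun j _ => ?_
          rw [sum_add_distrib, sum_comm]
          congr 1
          rw [sum_comm]
      _ ≤ ∑ j : Fin (2 * J), δ := sum_le_sum fun j _ => le_trans
          (add_le_add (sum_le_sum fun t _ => herr t j) (sum_le_sum fun t _ => hleak t j)) hδ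
      _ = _ := by simp
  obtain ⟨f, hfpos, hf⟩ := exists_pos_weight_le hp hp1 hcost
  have herr0 : ∀ t j, 0 ≤ err f t j := fun t j =>
    mul_nonneg (by positivity) (sum_nonneg fun l _ => sum_nonneg fun y _ => (W t _).2.1 y)
  -- Each divergence must be nonnegative for a bound on the total cost to bound each summand; this
  -- uses that all codewords lie in the support of `p`.
  have hleak0 : ∀ t j, 0 ≤ leak f t j := fun t j => by
    have hG := sum_sub_sum_le_sum_mul_log_div (p := v f t j) (q := outputDist p (V t))
      (fun z => mul_nonneg (by positivity) (sum_nonneg fun l _ => (V t _).2.1 z))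
      (outputDist_nonneg hp _) (fun z hz => by
        have h0 := (sum_eq_zero_iff_of_nonneg
          fun s _ => mul_nonneg (hp s) ((V t s).2.1 z)).1 hz
        simp only [v]
        rw [sum_eq_zero, mul_zero]
        intro l _
        exact (mul_eq_zero.1 (h0 (f (j, l)) (mem_univ _))).resolve_left (hfpos _).ne')
    have h1 : ∑ z, v f t j z = 1 := by
      simp only [v]
      rw [← mul_sum, sum_comm, sum_congr rfl fun l _ =>
        show ∑ z, V t (f (j, l)) z = 1 from (V t (f (j, l))).2.2]
      simp [hLpos.ne']
    rw [h1, sum_outputDist hp1, sub_self] at hG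
    exact hG
  obtain ⟨e, he⟩ := exists_embedding_le_two_mul
    (fun j => add_nonneg (sum_nonneg fun t _ => herr0 t j) (sum_nonneg fun t _ => hleak0 t j))
    hδ0 hf
  refine ⟨fun j l => f (e j, l), fun j => D f (e j),
    fun i j hij => thresholdDec_disjoint _ _ (e.injective.ne hij), fun t j => ?_, fun t j => ?_,
    fun j l => hfpos _⟩
  · have h1 := single_le_sum (f := fun t => err f t (e j)) (fun t _ => herr0 t (e j)) (mem_univ t)
    have h2 := sum_nonneg fun t (_ : t ∈ univ) => hleak0 t (e j)
    exact (le_trans h1 (le_add_of_nonneg_right h2)).trans (he j)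
  · have h1 := single_le_sum (f := fun t => leak f t (e j)) (fun t _ => hleak0 t (e j))
      (mem_univ t)
    have h2 := sum_nonneg fun t (_ : t ∈ univ) => herr0 t (e j)
    exact (le_trans h1 (le_add_of_nonneg_left h2)).trans (he j)

end OneShot

/-! ### Exponential decay for memoryless channels. -/

section Exponents

/-- The moment generating function is `1` at `s = 0` with derivative the mean, so a negative mean
pushes it below `1` just to the right of zero. The bound `s ≤ 1` serves `log_one_add_le_rpow_div`.
-/
lemma exists_sum_exp_lt_one {ι : Type*} [Fintype ι] {w c : ι → ℝ} (hw1 : ∑ i, w i = 1)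
    (hc : ∑ i, w i * c i < 0) :
    ∃ s : ℝ, 0 < s ∧ s ≤ 1 ∧ ∑ i, w i * Real.exp (s * c i) < 1 := by
  have hd : HasDerivAt (fun s : ℝ => ∑ i, w i * Real.exp (s * c i)) (∑ i, w i * c i) 0 := by
    refine HasDerivAt.fun_sum fun i _ => ?_
    have := (((hasDerivAt_id (0 : ℝ)).mul_const (c i)).exp).const_mul (w i)
    simpa using this
  have h0 : ∑ i, w i * Real.exp (0 * c i) = 1 := by simp [hw1]
  have hlt := (hasDerivAt_iff_tendsto_slope.1 hd).mono_left
    (nhdsWithin_mono 0 fun s (hs : s ∈ Set.Ioi (0 : ℝ)) => (Set.mem_Ioi.1 hs).ne')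
  have hev := hlt.eventually_lt_const hc
  have hev2 : ∀ᶠ s : ℝ in nhdsWithin 0 (Set.Ioi 0), s ∈ Set.Ioc (0 : ℝ) 1 :=
    Ioc_mem_nhdsGT one_pos
  obtain ⟨s, hs1, hs2⟩ := (hev.and hev2).exists
  refine ⟨s, hs2.1, hs2.2, ?_⟩
  rw [slope_def_field, h0, sub_zero, div_lt_iff₀ hs2.1, zero_mul] at hs1
  linarith

/-- Subadditivity gives `(1 + x) ^ s ≤ 1 + x ^ s`; take logarithms and use `log (1 + u) ≤ u`. -/
lemma log_one_add_le_rpow_div {x s : ℝ} (hx : 0 ≤ x) (hs : 0 < s) (hs1 : s ≤ 1) :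
    Real.log (1 + x) ≤ x ^ s / s := by
  have h1 := Real.rpow_add_le_add_rpow zero_le_one hx hs.le hs1
  rw [Real.one_rpow] at h1
  have h2 := Real.log_le_log (by positivity) h1
  rw [Real.log_rpow (by positivity)] at h2
  have h3 := Real.log_le_sub_one_of_pos (show 0 < 1 + x ^ s by positivity)
  rw [le_div_iff₀ hs]
  linarith

/-- The law of `n` independent copies. -/
def iidWeight {S : Type*} (p : S → ℝ) (n : ℕ) (x : Fin n → S) : ℝ := ∏ i, p (x i)

lemma iidWeight_nonneg {S : Type*} {p : S → ℝ} (hp : ∀ s, 0 ≤ p s) (n : ℕ) (x : Fin n → S) :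
    0 ≤ iidWeight p n x := prod_nonneg fun _ _ => hp _

lemma memoryless_apply {S Y : Type*} [Fintype Y] (W : Channel S Y) (n : ℕ) (x : Fin n → S)
    (y : Fin n → Y) : memoryless W n x y = ∏ i, W (x i) (y i) := rfl

variable {S Y : Type*} [Fintype S] [Fintype Y]

lemma sum_iidWeight {p : S → ℝ} (hp1 : ∑ s, p s = 1) (n : ℕ) : ∑ x, iidWeight p n x = 1 :=
  sum_iid hp1

lemma sum_sum_prod_eq_pow (g : S → Y → ℝ) (n : ℕ) :
    ∑ x : Fin n → S, ∑ y : Fin n → Y, ∏ i, g (x i) (y i) = (∑ s, ∑ y, g s y) ^ n := by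
  classical
  have : ∀ x : Fin n → S, ∑ y : Fin n → Y, ∏ i, g (x i) (y i) = ∏ i, ∑ y, g (x i) y := fun x =>
    (Fintype.prod_sum fun i y => g (x i) y).symm
  simp_rw [this]
  rw [← Fintype.prod_sum fun (_ : Fin n) s => ∑ y, g s y]
  simp

lemma outputDist_iidWeight (p : S → ℝ) (W : Channel S Y) (n : ℕ) (y : Fin n → Y) :
    outputDist (iidWeight p n) (memoryless W n) y = ∏ i, outputDist p W (y i) := by
  classical
  simp only [outputDist, memoryless_apply, iidWeight, ← prod_mul_distrib]
  exact (Fintype.prod_sum fun i s => p s * W s (y i)).symm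

lemma outputDist_pos {p : S → ℝ} (hp : ∀ s, 0 ≤ p s) {W : Channel S Y} {s : S} {y : Y}
    (h : 0 < p s * W s y) : 0 < outputDist p W y :=
  h.trans_le (single_le_sum (f := fun s => p s * W s y)
    (fun s _ => mul_nonneg (hp s) ((W s).2.1 y)) (mem_univ s))

lemma sum_joint {p : S → ℝ} (hp1 : ∑ s, p s = 1) (W : Channel S Y) :
    ∑ s, ∑ y, p s * W s y = 1 := by
  rw [sum_comm]
  exact sum_outputDist hp1 W

lemma mutualInfo_joint_mul_log_two {p : S → ℝ} (hp : ∀ s, 0 ≤ p s) (W : Channel S Y) :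
    mutualInfo (fun s y => p s * W s y) * Real.log 2 =
      ∑ s, ∑ y, p s * W s y * Real.log (W s y / outputDist p W y) := by
  rw [mutualInfo_mul_log_two]
  refine sum_congr rfl fun s _ => sum_congr rfl fun y _ => ?_
  rw [← mul_sum, show ∑ y, W s y = 1 from (W s).2.2, mul_one]
  rcases (hp s).eq_or_lt with h | h
  · simp [← h]
  rw [mul_div_mul_left _ _ h.ne']
  rfl

/-- The two-variable moment generating function of the information density is below one for a
suitable parameter, when the mean is negative. -/
lemma exists_joint_exp_lt_one {p : S → ℝ} (hp1 : ∑ s, p s = 1)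
    (W : Channel S Y) {c : S → Y → ℝ} (hc : ∑ s, ∑ y, p s * W s y * c s y < 0) :
    ∃ s : ℝ, 0 < s ∧ s ≤ 1 ∧ ∑ a, ∑ y, p a * W a y * Real.exp (s * c a y) < 1 := by
  obtain ⟨s, h1, h2, h3⟩ := exists_sum_exp_lt_one (ι := S × Y)
    (w := fun i => p i.1 * W i.1 i.2) (c := fun i => c i.1 i.2)
    (by rw [Fintype.sum_prod_type]; exact sum_joint hp1 W)
    (by rw [Fintype.sum_prod_type]; exact hc)
  rw [Fintype.sum_prod_type] at h3
  exact ⟨s, h1, h2, h3⟩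

/-- The Chernoff method: the exponential of a sum factorises over the letters. Pairs of words
outside the support have weight zero, so the pointwise bound is needed only on the support. -/
lemma sum_sum_le_pow_of_le {p : S → ℝ} (hp : ∀ s, 0 ≤ p s) (W : Channel S Y) {n : ℕ}
    {F : (Fin n → S) → (Fin n → Y) → ℝ} {C s : ℝ} {c : S → Y → ℝ}
    (h : ∀ x y, (∀ i, 0 < p (x i) * W (x i) (y i)) →
      F x y ≤ C * Real.exp (s * ∑ i, c (x i) (y i))) :
    ∑ x, iidWeight p n x * ∑ y, memoryless W n x y * F x y ≤
      C * (∑ a, ∑ y, p a * W a y * Real.exp (s * c a y)) ^ n := by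
  rw [← sum_sum_prod_eq_pow (fun a y => p a * W a y * Real.exp (s * c a y)) n, mul_sum]
  refine sum_le_sum fun x _ => ?_
  rw [mul_sum, mul_sum]
  refine sum_le_sum fun y _ => ?_
  rw [prod_mul_distrib, ← Real.exp_sum, ← mul_sum, ← mul_assoc, memoryless_apply, iidWeight,
    ← prod_mul_distrib]
  by_cases hpos : ∀ i, 0 < p (x i) * W (x i) (y i)
  · calc _ ≤ (∏ i, p (x i) * W (x i) (y i)) * (C * Real.exp (s * ∑ i, c (x i) (y i))) :=
          mul_le_mul_of_nonneg_left (h x y hpos) (prod_nonneg fun i _ => (hpos i).le)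
      _ = _ := by ring
  · push Not at hpos
    obtain ⟨i, hi⟩ := hpos
    have h0 : p (x i) * W (x i) (y i) = 0 := le_antisymm hi (mul_nonneg (hp _) ((W _).2.1 _))
    rw [prod_eq_zero (mem_univ i) h0]
    simp

lemma log_prod_div_prod {p : S → ℝ} (hp : ∀ s, 0 ≤ p s) (W : Channel S Y) {n : ℕ}
    {x : Fin n → S} {y : Fin n → Y} (h : ∀ i, 0 < p (x i) * W (x i) (y i)) :
    Real.log (memoryless W n x y / outputDist (iidWeight p n) (memoryless W n) y) =
      ∑ i, Real.log (W (x i) (y i) / outputDist p W (y i)) := by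
  rw [outputDist_iidWeight, memoryless_apply, ← prod_div_distrib, Real.log_prod]
  intro i _
  have h1 := outputDist_pos hp (h i)
  have h2 := pos_of_mul_pos_right (h i) (hp _)
  exact (div_pos h2 h1).ne'

/-- A miss means that the information density, a sum of i.i.d. terms of mean `I log 2`, is at most
`n γ` with `γ` below that mean: a lower large deviation. -/
lemma exists_missProb_le_pow {p : S → ℝ} (hp : ∀ s, 0 ≤ p s) (hp1 : ∑ s, p s = 1)
    (W : Channel S Y) {γ : ℝ} (hγ : γ < mutualInfo (fun s y => p s * W s y) * Real.log 2) :
    ∃ ρ : ℝ, 0 ≤ ρ ∧ ρ < 1 ∧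
      ∀ n : ℕ, missProb (iidWeight p n) (memoryless W n) (Real.exp (n * γ)) ≤ ρ ^ n := by
  obtain ⟨s, hs, -, hlt⟩ := exists_joint_exp_lt_one hp1 W
    (c := fun a y => γ - Real.log (W a y / outputDist p W y)) (by
      rw [mutualInfo_joint_mul_log_two hp W] at hγ
      simp_rw [mul_sub, sum_sub_distrib]
      simp_rw [← sum_mul]
      rw [sum_joint hp1 W, one_mul]
      linarith)
  refine ⟨_, sum_nonneg fun a _ => sum_nonneg fun y _ =>
    mul_nonneg (mul_nonneg (hp a) ((W a).2.1 y)) (Real.exp_pos _).le, hlt, fun n => ?_⟩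
  have := sum_sum_le_pow_of_le hp W (n := n) (C := 1) (s := s)
    (c := fun a y => γ - Real.log (W a y / outputDist p W y))
    (F := fun x y => open Classical in if Real.exp (n * γ) *
      outputDist (iidWeight p n) (memoryless W n) y < memoryless W n x y then 0 else 1) ?_
  · rw [one_mul] at this
    exact this
  intro x y hpos
  split_ifs with h
  · positivity
  rw [one_mul, sum_sub_distrib, ← log_prod_div_prod hp W hpos, Real.one_le_exp_iff, sum_const,
    card_univ, Fintype.card_fin, nsmul_eq_mul]
  refine mul_nonneg hs.le (sub_nonneg.2 ?_)
  have hW : 0 < memoryless W n x y := by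
    rw [memoryless_apply]
    exact prod_pos fun i _ => pos_of_mul_pos_right (hpos i) (hp _)
  have hq : 0 < outputDist (iidWeight p n) (memoryless W n) y := by
    rw [outputDist_iidWeight]
    exact prod_pos fun i _ => outputDist_pos hp (hpos i)
  rw [Real.log_le_iff_le_exp (div_pos hW hq), div_le_iff₀ hq]
  exact not_lt.1 h

/-- Bounding `log (1 + x)` by `x ^ s / s` turns the resolvability bound into an exponential moment
of the information density minus `R`, whose mean is negative. -/
lemma exists_resolvBound_le_pow {p : S → ℝ} (hp : ∀ s, 0 ≤ p s) (hp1 : ∑ s, p s = 1)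
    (V : Channel S Y) {R : ℝ} (hR : mutualInfo (fun s y => p s * V s y) * Real.log 2 < R) :
    ∃ ρ C : ℝ, 0 ≤ ρ ∧ ρ < 1 ∧ ∀ n L : ℕ, Real.exp (n * R) ≤ L →
      resolvBound (iidWeight p n) (memoryless V n) L ≤ C * ρ ^ n := by
  obtain ⟨s, hs, hs1, hlt⟩ := exists_joint_exp_lt_one hp1 V
    (c := fun a y => Real.log (V a y / outputDist p V y) - R) (by
      rw [mutualInfo_joint_mul_log_two hp V] at hR
      simp_rw [mul_sub, sum_sub_distrib]
      simp_rw [← sum_mul]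
      rw [sum_joint hp1 V, one_mul]
      linarith)
  refine ⟨_, 1 / s, sum_nonneg fun a _ => sum_nonneg fun y _ =>
    mul_nonneg (mul_nonneg (hp a) ((V a).2.1 y)) (Real.exp_pos _).le, hlt, fun n L hL => ?_⟩
  refine sum_sum_le_pow_of_le hp V ?_
  intro x y hpos
  have hV : 0 < memoryless V n x y := by
    rw [memoryless_apply]
    exact prod_pos fun i _ => pos_of_mul_pos_right (hpos i) (hp _)
  have hq : 0 < outputDist (iidWeight p n) (memoryless V n) y := by
    rw [outputDist_iidWeight]
    exact prod_pos fun i _ => outputDist_pos hp (hpos i)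
  have hLpos : (0 : ℝ) < L := (Real.exp_pos _).trans_le hL
  have hx : 0 < memoryless V n x y /
      (L * outputDist (iidWeight p n) (memoryless V n) y) := by positivity
  refine (log_one_add_le_rpow_div hx.le hs hs1).trans ?_
  rw [Real.rpow_def_of_pos hx, div_eq_inv_mul, one_div, mul_comm (Real.log _)]
  refine mul_le_mul_of_nonneg_left (Real.exp_le_exp.2 (mul_le_mul_of_nonneg_left ?_ hs.le))
    (by positivity)
  rw [sum_sub_distrib, ← log_prod_div_prod hp V hpos, sum_const, card_univ, Fintype.card_fin,
    nsmul_eq_mul, mul_comm (L : ℝ), ← div_div, Real.log_div (by positivity) hLpos.ne']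
  have := (Real.le_log_iff_exp_le hLpos).2 hL
  linarith

end Exponents

/-! ### Prefix channels and achievability of the single-letter gap. -/

section Achievability

/-- The concatenation of two channels. -/
noncomputable def compChannel {υ α β : Type*} [Fintype α] [Fintype β] (G : Channel υ α)
    (W : Channel α β) : Channel υ β := fun u =>
  ⟨fun y => ∑ x, G u x * W x y, fun y => sum_nonneg fun x _ => mul_nonneg ((G u).2.1 x)
    ((W x).2.1 y), by
    rw [sum_comm]
    simp_rw [← mul_sum]
    rw [← show ∑ x, G u x = 1 from (G u).2.2]
    exact sum_congr rfl fun x _ => by rw [show ∑ y, W x y = 1 from (W x).2.2, mul_one]⟩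

lemma compChannel_apply {υ α β : Type*} [Fintype α] [Fintype β] (G : Channel υ α)
    (W : Channel α β) (u : υ) (y : β) : compChannel G W u y = ∑ x, G u x * W x y := rfl

lemma memoryless_compChannel {υ α β : Type*} [Fintype α] [Fintype β] (G : Channel υ α)
    (W : Channel α β) (n : ℕ) (u : Fin n → υ) (y : Fin n → β) :
    memoryless (compChannel G W) n u y = ∑ x, memoryless G n u x * memoryless W n x y := by
  classical
  simp only [memoryless_apply, compChannel_apply, ← prod_mul_distrib]
  exact Fintype.prod_sum fun i x => G (u i) x * W x (y i)

lemma exists_dist (α : Type*) [Fintype α] [Nonempty α] : Nonempty (Dist α) := by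
  classical
  exact ⟨⟨_, single_mem_stdSimplex ℝ (Classical.arbitrary α)⟩⟩

/-- Disintegration of the joint law of `(U, X)`. -/
lemma exists_prefix {υ α : Type*} [Fintype υ] [Fintype α] [Nonempty α] (P : Dist (υ × α)) :
    ∃ (p : υ → ℝ) (G : Channel υ α), (∀ u, 0 ≤ p u) ∧ ∑ u, p u = 1 ∧
      ∀ u x, P (u, x) = p u * G u x := by
  classical
  obtain ⟨d⟩ := exists_dist α
  have hP : ∀ i, 0 ≤ P i := P.2.1
  set p : υ → ℝ := fun u => ∑ x, P (u, x) with hp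
  have hp0 : ∀ u, 0 ≤ p u := fun u => sum_nonneg fun x _ => hP _
  -- Where `p u = 0` the conditional law is immaterial, since the joint weights vanish there too;
  -- `d` is a filler.
  refine ⟨p, fun u => if h : p u = 0 then d else ⟨fun x => P (u, x) / p u,
    fun x => div_nonneg (hP _) (hp0 u), ?_⟩, hp0, ?_, fun u x => ?_⟩
  · rw [← sum_div]; exact div_self h
  · rw [← show ∑ i, P i = 1 from P.2.2, Fintype.sum_prod_type]
  · by_cases h : p u = 0
    · rw [h, zero_mul]
      exact (sum_eq_zero_iff_of_nonneg fun x _ => hP (u, x)).1 h x (mem_univ _)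
    · simp only [h, dif_neg, not_false_eq_true]
      exact (mul_div_cancel₀ _ h).symm

/-- Secrecy criterion: if every message's output law is within divergence `d` of one common law `Q`,
the leakage is at most `d` (in nats), because the true marginal is the best choice of `Q`. -/
lemma mutualInfo_uniform_le {β : Type*} [Fintype β] {J : ℕ} (hJ : 0 < J) {K : Fin J → β → ℝ}
    {Q : β → ℝ} (hK : ∀ j y, 0 ≤ K j y) (hK1 : ∀ j, ∑ y, K j y = 1) (hQ : ∀ y, 0 ≤ Q y)
    (hQ1 : ∑ y, Q y = 1) (hac : ∀ j y, Q y = 0 → K j y = 0) {d : ℝ}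
    (hd : ∀ j, ∑ y, K j y * Real.log (K j y / Q y) ≤ d) :
    mutualInfo (fun j y => 1 / (J : ℝ) * K j y) * Real.log 2 ≤ d := by
  have hJ' : (0 : ℝ) < J := Nat.cast_pos.2 hJ
  have hPU : ∀ j, ∑ y, 1 / (J : ℝ) * K j y = 1 / J := fun j => by rw [← mul_sum, hK1, mul_one]
  refine (mutualInfo_mul_log_two_le (Q := Q) (fun j y => mul_nonneg (by positivity) (hK j y)) hQ
    (fun j y h => by rw [hac j y h, mul_zero]) ?_).trans ?_
  · simp_rw [hPU]; simp [hQ1, hJ'.ne']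
  · simp_rw [hPU]
    calc _ = 1 / (J : ℝ) * ∑ j, ∑ y, K j y * Real.log (K j y / Q y) := by
          simp_rw [mul_sum]
          refine sum_congr rfl fun j _ => sum_congr rfl fun y _ => ?_
          rw [mul_div_mul_left _ _ (by positivity)]; ring
      _ ≤ 1 / (J : ℝ) * ∑ j : Fin J, d := by gcongr with j; exact hd j
      _ = d := by simp [hJ'.ne']

variable {θ A B C : Type*} [Fintype A] [Fintype B] [DecidableEq B] [Fintype C]

/-- The error probabilities of all messages and the leaked information are at most `ε`, for every
channel state. -/
def Code.IsGood {n J : ℕ} (c : Code A B n J) (W : θ → Channel A B) (V : θ → Channel A C)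
    (ε : ℝ) : Prop :=
  (∀ t j, ∑ x, c.enc j x * ∑ y ∈ (c.dec j)ᶜ, memoryless (W t) n x y ≤ ε) ∧
    ∀ t, mutualInfo (c.leakLaw (V t)) ≤ ε

/-- For every `ε > 0` and every large block length there is an `ε`-good code of rate at least
`R - ε`. -/
def EventuallyAchievable (W : θ → Channel A B) (V : θ → Channel A C) (R : ℝ) : Prop :=
  ∀ ε : ℝ, 0 < ε → ∃ N : ℕ, ∀ n ≥ N, ∃ J : ℕ, 0 < J ∧ ∃ c : Code A B n J,
    c.IsGood W V ε ∧ n * (R - ε) ≤ Real.logb 2 J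

/-- A code with one message has neither errors nor leakage. -/
lemma exists_isGood_one [Nonempty A] (W : θ → Channel A B) (V : θ → Channel A C) (n : ℕ) {ε : ℝ}
    (hε : 0 ≤ ε) : ∃ c : Code A B n 1, c.IsGood W V ε := by
  obtain ⟨d⟩ := exists_dist (Fin n → A)
  refine ⟨⟨fun _ => d, fun _ => univ, fun i j h => (h (Subsingleton.elim i j)).elim⟩,
    fun t j => by simpa using hε, fun t => ?_⟩
  refine le_trans (le_of_eq ?_) hε
  unfold mutualInfo
  refine sum_eq_zero fun j _ => sum_eq_zero fun z _ => ?_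
  set c : Code A B n 1 := ⟨fun _ => d, fun _ => univ, fun i j h => (h (Subsingleton.elim i j)).elim⟩
  have h1 : ∑ z, c.leakLaw (V t) j z = 1 := by
    simp only [Code.leakLaw, Nat.cast_one, div_one, one_mul]
    exact (compChannel c.enc (memoryless (V t) n) j).2.2
  rw [h1, one_mul, Fin.sum_univ_one, Subsingleton.elim j 0]
  by_cases h0 : c.leakLaw (V t) 0 z = 0
  · simp [h0]
  · simp [div_self h0]

lemma sum_enc_mul {υ α β : Type*} [Fintype α] (G : υ → α → ℝ)
    (s : Finset β) (F : α → β → ℝ) {L : ℕ} (u : Fin L → υ) (r : ℝ) :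
    ∑ x, (r * ∑ l, G (u l) x) * ∑ y ∈ s, F x y =
      r * ∑ l, ∑ y ∈ s, ∑ x, G (u l) x * F x y := by
  simp_rw [mul_assoc, ← mul_sum, sum_mul, mul_sum]
  rw [sum_comm]
  refine sum_congr rfl fun l _ => ?_
  rw [sum_comm]

lemma outputDist_iidWeight_ac {S Z : Type*} [Fintype S] [Fintype Z] {p : S → ℝ}
    (hp : ∀ s, 0 ≤ p s) {V : Channel S Z} {s : S} (hs : 0 < p s) {z : Z}
    (h : outputDist p V z = 0) : V s z = 0 :=
  (mul_eq_zero.1 ((sum_eq_zero_iff_of_nonneg fun s _ => mul_nonneg (hp s) ((V s).2.1 z)).1 h s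
    (mem_univ _))).resolve_left hs.ne'

/-- Codes from random coding over the input alphabet of a prefix channel `G`. -/
lemma exists_isGood_of_bounds [Fintype θ] {υ : Type*} [Fintype υ] {p : υ → ℝ} (hp : ∀ u, 0 ≤ p u)
    (hp1 : ∑ u, p u = 1) (G : Channel υ A) (W : θ → Channel A B) (V : θ → Channel A C)
    (n : ℕ) {Γ : ℝ} (hΓ : 0 < Γ) {J L : ℕ} (hJ : 0 < J) (hL : 0 < L) {δ : ℝ} (hδ0 : 0 ≤ δ)
    (hδ : ∑ t, (missProb (iidWeight p n) (memoryless (compChannel G (W t)) n) Γ +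
        Fintype.card θ * (2 * J * L) / Γ) +
      ∑ t, resolvBound (iidWeight p n) (memoryless (compChannel G (V t)) n) L ≤ δ) :
    ∃ c : Code A B n J, (∀ t j, ∑ x, c.enc j x * ∑ y ∈ (c.dec j)ᶜ, memoryless (W t) n x y ≤ 2 * δ) ∧
      ∀ t, mutualInfo (c.leakLaw (V t)) * Real.log 2 ≤ 2 * δ := by
  obtain ⟨u, D, hD, herr, hleak, hpos⟩ := exists_codebook (iidWeight_nonneg hp n)
    (sum_iidWeight hp1 n) (fun t => memoryless (compChannel G (W t)) n)
    (fun t => memoryless (compChannel G (V t)) n) hΓ hL hδ0 hδ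
  have hL' : (0 : ℝ) < L := Nat.cast_pos.2 hL
  refine ⟨⟨fun j => ⟨fun x => 1 / (L : ℝ) * ∑ l, memoryless G n (u j l) x,
    fun x => mul_nonneg (by positivity) (sum_nonneg fun l _ => (memoryless G n _).2.1 x), ?_⟩,
    D, hD⟩, fun t j => ?_, fun t => ?_⟩
  · rw [← mul_sum, sum_comm, sum_congr rfl fun l _ =>
      show ∑ x, memoryless G n (u j l) x = 1 from (memoryless G n (u j l)).2.2]
    simp [hL'.ne']
  · refine le_trans (le_of_eq ?_) (herr t j)
    simp only [memoryless_compChannel]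
    exact sum_enc_mul (fun a b => memoryless G n a b) _ (fun x y => memoryless (W t) n x y) (u j) _
  · have := mutualInfo_uniform_le hJ
      (K := fun j z => 1 / (L : ℝ) * ∑ l, memoryless (compChannel G (V t)) n (u j l) z)
      (Q := outputDist (iidWeight p n) (memoryless (compChannel G (V t)) n))
      (fun j z => mul_nonneg (by positivity) (sum_nonneg fun l _ => (memoryless _ n _).2.1 z))
      (fun j => by
        rw [← mul_sum, sum_comm, sum_congr rfl fun l _ => show
          ∑ x, memoryless (compChannel G (V t)) n (u j l) x = 1 from (memoryless _ n (u j l)).2.2]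
        simp [hL'.ne'])
      (outputDist_nonneg (iidWeight_nonneg hp n) _) (sum_outputDist (sum_iidWeight hp1 n) _)
      (fun j z h => by
        rw [sum_eq_zero, mul_zero]
        exact fun l _ => outputDist_iidWeight_ac (iidWeight_nonneg hp n) (hpos j l) h)
      (hleak t)
    refine le_trans (le_of_eq ?_) this
    congr 2
    funext j z
    simp only [Code.leakLaw, memoryless_compChannel]
    congr 1
    have := sum_enc_mul (fun a b => memoryless G n a b) {z} (fun x y => memoryless (V t) n x y)
      (u j) (1 / (L : ℝ))
    simp only [sum_singleton] at this
    exact this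

lemma outputLaw_eq {υ : Type*} [Fintype υ] {P : Dist (υ × A)} {p : υ → ℝ} {G : Channel υ A}
    (h : ∀ u x, P (u, x) = p u * G u x) {β : Type*} [Fintype β] (W : Channel A β) :
    outputLaw P W = fun u y => p u * compChannel G W u y := by
  funext u y
  simp only [outputLaw, h, compChannel_apply, mul_sum, mul_assoc]

/-- Every value of `min_t I(U; Y_t) - max_t I(U; Z_t)` is achievable. -/
theorem eventuallyAchievable_rateGap [Fintype θ] [Nonempty A] [Nonempty θ] {υ : Type*} [Fintype υ]
    (W : θ → Channel A B) (V : θ → Channel A C) (P : Dist (υ × A)) :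
    EventuallyAchievable W V (rateGap W V P) := by
  intro ε hε
  -- A nonpositive target rate is met by a single message; the main argument needs positive
  -- exponents so that rounding up costs at most a factor two.
  rcases le_or_gt (rateGap W V P - ε) 0 with hR | hR
  · refine ⟨0, fun n _ => ⟨1, one_pos, ?_⟩⟩
    obtain ⟨c, hc⟩ := exists_isGood_one W V n hε.le
    refine ⟨c, hc, ?_⟩
    simpa using mul_nonpos_of_nonneg_of_nonpos (Nat.cast_nonneg n) hR
  obtain ⟨p, G, hp, hp1, hPG⟩ := exists_prefix P
  have hlog2 : 0 < Real.log 2 := Real.log_pos one_lt_two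
  have hlog2' : Real.log 2 ≤ 1 := by linarith [Real.log_two_lt_d9]
  set IY := (⨅ t, mutualInfo (outputLaw P (W t))) with hIY
  set IZ := (⨆ t, mutualInfo (outputLaw P (V t))) with hIZ
  have hIYt : ∀ t, IY ≤ mutualInfo (outputLaw P (W t)) := fun t =>
    ciInf_le (Set.finite_range _).bddBelow t
  have hIZt : ∀ t, mutualInfo (outputLaw P (V t)) ≤ IZ := fun t =>
    le_ciSup (f := fun t => mutualInfo (outputLaw P (V t))) (Set.finite_range _).bddAbove t
  have hIZ0 : 0 ≤ IZ := by
    refine le_trans ?_ (hIZt (Classical.arbitrary θ))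
    rw [outputLaw_eq hPG]
    exact mutualInfo_nonneg (fun u y => mul_nonneg (hp u) ((compChannel G _ u).2.1 y))
      (sum_joint hp1 _)
  -- All exponents are in nats. With this `η` one gets `RJ + RL = γ - 2 η`, so the number of
  -- codewords is exponentially below the threshold `exp (n γ)`, while `γ` and `RL` stay `η` away
  -- from their information bounds.
  set η := ε * Real.log 2 / 4 with hη
  have hη0 : 0 < η := by positivity
  set γ := IY * Real.log 2 - η with hγ
  set RL := IZ * Real.log 2 + η with hRL
  set RJ := (IY - IZ - ε) * Real.log 2 with hRJ
  have hRJ0 : 0 < RJ := mul_pos hR hlog2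
  have hRL0 : 0 < RL := by positivity
  have hmiss : ∀ t, ∃ ρ : ℝ, 0 ≤ ρ ∧ ρ < 1 ∧ ∀ n : ℕ, missProb (iidWeight p n)
      (memoryless (compChannel G (W t)) n) (Real.exp (n * γ)) ≤ ρ ^ n := fun t =>
    exists_missProb_le_pow hp hp1 _ (by
      have := mul_le_mul_of_nonneg_right (hIYt t) hlog2.le
      rw [outputLaw_eq hPG] at this
      linarith)
  have hres : ∀ t, ∃ ρ C : ℝ, 0 ≤ ρ ∧ ρ < 1 ∧ ∀ n L : ℕ, Real.exp (n * RL) ≤ L →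
      resolvBound (iidWeight p n) (memoryless (compChannel G (V t)) n) L ≤ C * ρ ^ n := fun t =>
    exists_resolvBound_le_pow hp hp1 _ (by
      have := mul_le_mul_of_nonneg_right (hIZt t) hlog2.le
      rw [outputLaw_eq hPG] at this
      linarith)
  choose ρ hρ0 hρ1 hρ using hmiss
  choose σ K hσ0 hσ1 hσ using hres
  have hlim : Filter.Tendsto (fun n : ℕ => ∑ t, (ρ t ^ n + Fintype.card θ * 8 *
      Real.exp (-(2 * η)) ^ n) + ∑ t, K t * σ t ^ n) Filter.atTop (nhds 0) := by
    have h1 : ∑ t : θ, ((0 : ℝ) + Fintype.card θ * 8 * 0) + ∑ t, K t * 0 = 0 := by simp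
    rw [← h1]
    refine Filter.Tendsto.add (tendsto_finsetSum _ fun t _ => Filter.Tendsto.add
      (tendsto_pow_atTop_nhds_zero_of_lt_one (hρ0 t) (hρ1 t)) (Filter.Tendsto.const_mul _
      (tendsto_pow_atTop_nhds_zero_of_lt_one (Real.exp_pos _).le ?_)))
      (tendsto_finsetSum _ fun t _ => Filter.Tendsto.const_mul _
      (tendsto_pow_atTop_nhds_zero_of_lt_one (hσ0 t) (hσ1 t)))
    rw [Real.exp_lt_one_iff]
    linarith
  obtain ⟨N, hN⟩ := Filter.eventually_atTop.1 (hlim.eventually_le_const hη0)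
  refine ⟨N, fun n hn => ?_⟩
  have hceil : ∀ r : ℝ, 0 < r → (⌈Real.exp (n * r)⌉₊ : ℝ) ≤ 2 * Real.exp (n * r) := fun r hr => by
    have h1 : 1 ≤ Real.exp (n * r) := Real.one_le_exp (by positivity)
    have := (Nat.ceil_lt_add_one (Real.exp_pos (n * r)).le).le
    linarith
  set J := ⌈Real.exp (n * RJ)⌉₊ with hJdef
  set L := ⌈Real.exp (n * RL)⌉₊ with hLdef
  have hJ : 0 < J := Nat.ceil_pos.2 (Real.exp_pos _)
  have hL : 0 < L := Nat.ceil_pos.2 (Real.exp_pos _)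
  have hJL : 2 * (J : ℝ) * L / Real.exp (n * γ) ≤ 8 * Real.exp (-(2 * η)) ^ n := by
    rw [div_le_iff₀ (Real.exp_pos _), ← Real.exp_nat_mul, mul_assoc 8, ← Real.exp_add]
    calc 2 * (J : ℝ) * L ≤ 2 * (2 * Real.exp (n * RJ)) * (2 * Real.exp (n * RL)) := by
          gcongr
          · exact hceil RJ hRJ0
          · exact hceil RL hRL0
      _ = 8 * Real.exp (n * RJ + n * RL) := by rw [Real.exp_add]; ring
      _ = _ := by
          congr 2
          rw [hRJ, hRL, hγ, hη]
          ring
  obtain ⟨c, hc1, hc2⟩ := exists_isGood_of_bounds hp hp1 G W V n (Real.exp_pos (n * γ)) hJ hL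
    hη0.le (le_trans (add_le_add (sum_le_sum fun t _ => add_le_add (hρ t n) (by
      rw [mul_div_assoc, mul_assoc (Fintype.card θ : ℝ) 8]
      exact mul_le_mul_of_nonneg_left hJL (Nat.cast_nonneg _)))
      (sum_le_sum fun t _ => hσ t n L (Nat.le_ceil _))) (hN n hn))
  refine ⟨J, hJ, c, ⟨fun t j => (hc1 t j).trans ?_, fun t => ?_⟩, ?_⟩
  · rw [hη]; nlinarith
  · refine le_of_mul_le_mul_right ((hc2 t).trans ?_) hlog2
    rw [hη]; nlinarith [mul_pos hε hlog2]
  · rw [Real.logb, le_div_iff₀ hlog2, Real.le_log_iff_exp_le (Nat.cast_pos.2 hJ)]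
    refine le_trans (le_of_eq ?_) (Nat.le_ceil _)
    rw [hRJ, ← mul_assoc]
    rfl

end Achievability

/-! ### From codes for blocks to codes for letters, at every block length. -/

section Blocks

lemma sum_compl_eq_sum_ite {α : Type*} [Fintype α] [DecidableEq α] (s : Finset α) (F : α → ℝ) :
    ∑ y ∈ sᶜ, F y = ∑ y, if y ∈ s then 0 else F y := by
  rw [← sum_filter_add_sum_filter_not univ (· ∈ s), sum_ite_of_true (by simp),
    sum_ite_of_false (by simp)]
  simp only [sum_const_zero, zero_add]
  exact sum_congr (by ext; simp) fun _ _ => rfl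

lemma sum_fin_succ_arrow {α : Type*} [Fintype α] (n : ℕ) (F : (Fin (n + 1) → α) → ℝ) :
    ∑ x, F x = ∑ a, ∑ x : Fin n → α, F (Fin.cons a x) := by
  rw [← (Fin.consEquiv fun _ => α).sum_comp, Fintype.sum_prod_type]
  rfl

lemma memoryless_cons {α β : Type*} [Fintype β] (W : Channel α β) (n : ℕ) (a : α)
    (x : Fin n → α) (b : β) (y : Fin n → β) :
    memoryless W (n + 1) (Fin.cons a x : Fin (n + 1) → α) (Fin.cons b y : Fin (n + 1) → β) =
      W a b * memoryless W n x y := by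
  simp [memoryless_apply, Fin.prod_univ_succ]

/-- Grouping a word of length `q * m` into `q` blocks of length `m`. -/
def blockEquiv (α : Type*) (q m : ℕ) : (Fin (q * m) → α) ≃ (Fin q → Fin m → α) :=
  (Equiv.arrowCongr finProdFinEquiv.symm (Equiv.refl α)).trans (Equiv.curry _ _ _)

lemma blockEquiv_apply {α : Type*} {q m : ℕ} (x : Fin (q * m) → α) (i : Fin q) (k : Fin m) :
    blockEquiv α q m x i k = x (finProdFinEquiv (i, k)) := rfl

lemma memoryless_memoryless {α β : Type*} [Fintype β] (W : Channel α β) (q m : ℕ)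
    (x : Fin (q * m) → α) (y : Fin (q * m) → β) :
    memoryless (memoryless W m) q (blockEquiv α q m x) (blockEquiv β q m y) =
      memoryless W (q * m) x y := by
  simp only [memoryless_apply, blockEquiv_apply]
  rw [← Fintype.prod_prod_type' fun i k =>
    W (x (finProdFinEquiv (i, k))) (y (finProdFinEquiv (i, k)))]
  exact finProdFinEquiv.prod_comp fun i => W (x i) (y i)

variable {θ A B C : Type*} [Fintype A] [Fintype B] [DecidableEq B] [Fintype C]

lemma Code.IsGood.exists_flatten {W : θ → Channel A B} {V : θ → Channel A C} {q m J : ℕ} {ε : ℝ}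
    {c : Code (Fin m → A) (Fin m → B) q J}
    (hc : c.IsGood (fun t => memoryless (W t) m) (fun t => memoryless (V t) m) ε) :
    ∃ c' : Code A B (q * m) J, c'.IsGood W V ε := by
  refine ⟨⟨fun j => ⟨fun x => c.enc j (blockEquiv A q m x), fun x => (c.enc j).2.1 _, ?_⟩,
    fun j => {y | blockEquiv B q m y ∈ c.dec j}, fun i j hij => ?_⟩, fun t j => ?_, fun t => ?_⟩
  · rw [(blockEquiv A q m).sum_comp (fun x => c.enc j x)]
    exact (c.enc j).2.2
  · rw [Finset.disjoint_left]
    intro y hy hy'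
    exact Finset.disjoint_left.1 (c.disjoint i j hij) (mem_filter.1 hy).2 (mem_filter.1 hy').2
  · refine le_trans (le_of_eq ?_) (hc.1 t j)
    rw [← (blockEquiv A q m).sum_comp]
    refine sum_congr rfl fun x _ => ?_
    refine congrArg₂ _ rfl (sum_equiv (blockEquiv B q m) (fun y => by simp) fun y _ => ?_)
    rw [memoryless_memoryless]
  · refine le_trans (le_of_eq ?_) (hc.2 t)
    rw [← mutualInfo_comp_equiv (Equiv.refl _) (blockEquiv C q m)]
    congr 1
    funext j z
    simp only [Code.leakLaw, Equiv.refl_apply]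
    congr 1
    refine Fintype.sum_equiv (blockEquiv A q m) _ _ fun x => ?_
    rw [memoryless_memoryless]
    rfl

/-- Prepend a fixed letter `a₀`: the decoder ignores the first output symbol, and the eavesdropper's
first symbol is independent of everything else, so neither error nor leakage changes. -/
lemma Code.IsGood.exists_succ [Nonempty A] {W : θ → Channel A B} {V : θ → Channel A C} {n J : ℕ}
    {ε : ℝ} {c : Code A B n J} (hc : c.IsGood W V ε) :
    ∃ c' : Code A B (n + 1) J, c'.IsGood W V ε := by
  classical
  let a₀ : A := Classical.arbitrary A
  let E (j : Fin J) (x : Fin (n + 1) → A) : ℝ := if x 0 = a₀ then c.enc j (Fin.tail x) else 0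
  have hE : ∀ j (F : (Fin (n + 1) → A) → ℝ),
      ∑ x, E j x * F x = ∑ x, c.enc j x * F (Fin.cons a₀ x) := fun j F => by
    rw [sum_fin_succ_arrow, sum_eq_single a₀]
    · simp [E]
    · intro a _ ha
      simp [E, ha]
    · simp
  refine ⟨⟨fun j => ⟨E j, fun x => ?_, ?_⟩,
    fun j => {y | Fin.tail y ∈ c.dec j}, fun i j hij => ?_⟩, fun t j => ?_, fun t => ?_⟩
  · simp only [E]
    split_ifs
    · exact (c.enc j).2.1 _
    · exact le_rfl
  · have := hE j (fun _ => 1)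
    simp only [mul_one] at this
    rw [this]
    exact (c.enc j).2.2
  · rw [Finset.disjoint_left]
    intro y hy hy'
    exact Finset.disjoint_left.1 (c.disjoint i j hij) (mem_filter.1 hy).2 (mem_filter.1 hy').2
  · refine le_trans (le_of_eq ?_) (hc.1 t j)
    refine (hE j fun x => _).trans (sum_congr rfl fun x _ => congrArg₂ _ rfl ?_)
    rw [sum_compl_eq_sum_ite, sum_compl_eq_sum_ite, sum_fin_succ_arrow, sum_comm]
    refine sum_congr rfl fun y _ => ?_
    simp only [mem_filter, mem_univ, true_and, Fin.tail_cons, memoryless_cons]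
    split_ifs
    · simp
    · rw [← sum_mul, show ∑ b, W t a₀ b = 1 from (W t a₀).2.2, one_mul]
  · refine le_trans (le_of_eq ?_) (hc.2 t)
    refine Eq.trans ?_ (mutualInfo_prod_indep (V t a₀) (V t a₀).2.2 _)
    refine Eq.trans ?_
      (mutualInfo_comp_equiv (Equiv.refl _) (Fin.consEquiv fun _ : Fin (n + 1) => C).symm _)
    congr 1
    funext j z
    simp only [Code.leakLaw, Equiv.refl_apply, Fin.consEquiv_symm_apply]
    rw [mul_assoc]
    congr 1
    refine (hE j fun x => memoryless (V t) (n + 1) x z).trans ?_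
    rw [sum_mul]
    refine sum_congr rfl fun x _ => ?_
    rw [← Fin.cons_self_tail z, memoryless_cons]
    simp only [Fin.cons_zero, Fin.tail_cons]
    ring

lemma Code.IsGood.exists_add [Nonempty A] {W : θ → Channel A B} {V : θ → Channel A C} {n J : ℕ}
    {ε : ℝ} {c : Code A B n J} (hc : c.IsGood W V ε) (r : ℕ) :
    ∃ c' : Code A B (n + r) J, c'.IsGood W V ε := by
  induction r with
  | zero => exact ⟨c, hc⟩
  | succ r ih =>
    obtain ⟨c', hc'⟩ := ih
    exact hc'.exists_succ

lemma Code.IsGood.mono {W : θ → Channel A B} {V : θ → Channel A C} {n J : ℕ} {ε ε' : ℝ}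
    {c : Code A B n J} (hc : c.IsGood W V ε) (h : ε ≤ ε') : c.IsGood W V ε' :=
  ⟨fun t j => (hc.1 t j).trans h, fun t => (hc.2 t).trans h⟩

/-- Coding for the `m`-th memoryless extension. -/
theorem EventuallyAchievable.of_blocks [Nonempty A] {W : θ → Channel A B} {V : θ → Channel A C}
    {m : ℕ} (hm : 0 < m) {R : ℝ}
    (h : EventuallyAchievable (fun t => memoryless (W t) m) (fun t => memoryless (V t) m) R) :
    EventuallyAchievable W V (1 / (m : ℝ) * R) := by
  intro ε hε
  have hm' : (0 : ℝ) < m := Nat.cast_pos.2 hm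
  obtain ⟨N, hN⟩ := h (ε / 2) (half_pos hε)
  -- The `n % m` padding letters lose at most `|R|` bits, which is at most `ε n / 2` for such `n`;
  -- the other half of `ε` is the slack of the block code.
  obtain ⟨N', hN'⟩ := exists_nat_gt (2 * |R| / ε)
  refine ⟨max (N * m) N', fun n hn => ?_⟩
  have hq : N ≤ n / m := (Nat.le_div_iff_mul_le hm).2 ((le_max_left _ _).trans hn)
  obtain ⟨J, hJ, c, hc, hrate⟩ := hN (n / m) hq
  obtain ⟨c1, hc1⟩ := hc.exists_flatten
  obtain ⟨c2, hc2⟩ := hc1.exists_add (n % m)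
  have hn' : n / m * m + n % m = n := Nat.div_add_mod' n m
  refine ⟨J, hJ, ?_⟩
  generalize hlen : n / m * m + n % m = k at c2 hc2
  obtain rfl : k = n := hlen.symm.trans hn'
  refine ⟨c2, hc2.mono (half_le_self hε.le), le_trans ?_ hrate⟩
  set q := k / m with hqdef
  have h1 : (k : ℝ) = q * m + (k % m : ℕ) := by exact_mod_cast hn'.symm
  have h2 : ((k % m : ℕ) : ℝ) ≤ m := by exact_mod_cast (Nat.mod_lt k hm).le
  have h3 : (0 : ℝ) ≤ (k % m : ℕ) := Nat.cast_nonneg _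
  have h4 : 2 * |R| ≤ ε * k := by
    have : (N' : ℝ) ≤ k := by exact_mod_cast (le_max_right _ _).trans hn
    have := hN'.le.trans this
    rw [div_le_iff₀ hε] at this
    linarith
  have h5 : (k : ℝ) / m - q = (k % m : ℕ) / m := by rw [h1]; field_simp; ring
  have h6 : 0 ≤ ((k % m : ℕ) : ℝ) / m := by positivity
  have h7 : ((k % m : ℕ) : ℝ) / m ≤ 1 := (div_le_one hm').2 h2
  have h8 : (q : ℝ) ≤ k := by exact_mod_cast Nat.div_le_self k m
  have h9 : ((k : ℝ) / m - q) * R ≤ |R| := by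
    rw [h5]
    calc _ ≤ ((k % m : ℕ) : ℝ) / m * |R| := mul_le_mul_of_nonneg_left (le_abs_self R) h6
      _ ≤ _ := mul_le_of_le_one_left (abs_nonneg R) h7
  have h10 : (k : ℝ) * (1 / m * R - ε) = q * R + ((k : ℝ) / m - q) * R - k * ε := by ring
  rw [h10]
  nlinarith

end Blocks

/-! ### The capacity is attained, and equals the limit of the normalised block maxima. -/

section Capacity

variable {θ A B C : Type*} [Fintype A] [Fintype C]

lemma Code.leakLaw_nonneg {n J : ℕ} (c : Code A B n J) (V : Channel A C) (j : Fin J)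
    (z : Fin n → C) : 0 ≤ c.leakLaw V j z :=
  mul_nonneg (by positivity)
    (sum_nonneg fun x _ => mul_nonneg ((c.enc j).2.1 x) ((memoryless V n x).2.1 z))

lemma Code.sum_leakLaw {n J : ℕ} (hJ : 0 < J) (c : Code A B n J) (V : Channel A C) :
    ∑ j, ∑ z, c.leakLaw V j z = 1 := by
  have h : ∀ j, ∑ z, c.leakLaw V j z = 1 / J := fun j => by
    simp only [Code.leakLaw]
    rw [← mul_sum, show ∑ z, ∑ x, c.enc j x * memoryless V n x z = 1 from
      (compChannel c.enc (memoryless V n) j).2.2, mul_one]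
  simp_rw [h]
  have : (J : ℝ) ≠ 0 := Nat.cast_ne_zero.2 hJ.ne'
  simp [this]

lemma Code.leakage_nonneg {n J : ℕ} (hJ : 0 < J) (c : Code A B n J) (V : θ → Channel A C) :
    0 ≤ c.leakage V :=
  Real.iSup_nonneg fun _ => mutualInfo_nonneg (c.leakLaw_nonneg _) (c.sum_leakLaw hJ _)

variable [Fintype B] [DecidableEq B]

lemma Code.error_nonneg {n J : ℕ} (c : Code A B n J) (W : θ → Channel A B) : 0 ≤ c.error W :=
  Real.iSup_nonneg fun t => Real.iSup_nonneg fun j => sum_nonneg fun x _ =>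
    mul_nonneg ((c.enc j).2.1 x) (sum_nonneg fun y _ => (memoryless (W t) n x).2.1 y)

lemma Code.isGood_iff [Fintype θ] [Nonempty θ] {n J : ℕ} (hJ : 0 < J) (c : Code A B n J)
    (W : θ → Channel A B) (V : θ → Channel A C) (ε : ℝ) :
    c.IsGood W V ε ↔ c.error W ≤ ε ∧ c.leakage V ≤ ε := by
  have : Nonempty (Fin J) := ⟨⟨0, hJ⟩⟩
  refine ⟨fun h => ⟨ciSup_le fun t => ciSup_le fun j => h.1 t j, ciSup_le fun t => h.2 t⟩,
    fun h => ⟨fun t j => ?_, fun t => ?_⟩⟩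
  · exact ((le_ciSup (f := fun j => ∑ x, c.enc j x * ∑ y ∈ (c.dec j)ᶜ, memoryless (W t) n x y)
      (Set.finite_range _).bddAbove j).trans
      (le_ciSup (f := fun t => ⨆ j, ∑ x, c.enc j x * ∑ y ∈ (c.dec j)ᶜ, memoryless (W t) n x y)
      (Set.finite_range _).bddAbove t)).trans h.1
  · exact (le_ciSup (f := fun t => mutualInfo (c.leakLaw (V t)))
      (Set.finite_range _).bddAbove t).trans h.2

lemma IsAchievable.eventuallyAchievable [Fintype θ] [Nonempty θ] {W : θ → Channel A B}
    {V : θ → Channel A C}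
    {R : ℝ} (h : IsAchievable W V R) : EventuallyAchievable W V R := by
  obtain ⟨-, J, c, hJ, herr, hrate, hleak⟩ := h
  intro ε hε
  have h1 : ((R - ε : ℝ) : EReal) < Filter.liminf (fun n : ℕ =>
      ((1 / (n : ℝ) * Real.logb 2 (J n) : ℝ) : EReal)) Filter.atTop :=
    lt_of_lt_of_le (EReal.coe_lt_coe_iff.2 (sub_lt_self R hε)) hrate
  have h2 := Filter.eventually_lt_of_lt_liminf h1
  obtain ⟨N, hN⟩ := Filter.eventually_atTop.1 (((herr.eventually_le_const hε).and
    (hleak.eventually_le_const hε)).and (h2.and (Filter.eventually_gt_atTop 0)))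
  refine ⟨N, fun n hn => ⟨J n, hJ n, c n, (Code.isGood_iff (hJ n) _ _ _ _).2 (hN n hn).1, ?_⟩⟩
  obtain ⟨h3, h4⟩ := (hN n hn).2
  have h5 := EReal.coe_lt_coe_iff.1 h3
  have h6 : (0 : ℝ) < n := Nat.cast_pos.2 h4
  rw [one_div_mul_eq_div, lt_div_iff₀ h6] at h5
  linarith

/-- Diagonal argument: at length `n` use a code of the best quality `1 / k`, `k ≤ n`, available at
that length. Each `k` is available eventually, so the quality tends to zero along a single sequence
of codes. -/
lemma EventuallyAchievable.isAchievable [Fintype θ] [Nonempty A] [Nonempty θ] {W : θ → Channel A B}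
    {V : θ → Channel A C} {R : ℝ} (hR : 0 ≤ R) (h : EventuallyAchievable W V R) :
    IsAchievable W V R := by
  classical
  -- `k = 0` imposes no condition, so the search for the greatest `k` always has a valid starting
  -- value.
  let good (k n : ℕ) : Prop := ∃ J : ℕ, 0 < J ∧ ∃ c : Code A B n J, k = 0 ∨
    (c.IsGood W V (1 / k) ∧ n * (R - 1 / k) ≤ Real.logb 2 J)
  have hgood0 : ∀ n, good 0 n := fun n =>
    ⟨1, one_pos, (exists_isGood_one W V n zero_le_one).choose, Or.inl rfl⟩
  let K (n : ℕ) : ℕ := Nat.findGreatest (fun k => good k n) n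
  have hK : ∀ n, good (K n) n := fun n =>
    Nat.findGreatest_spec (P := fun k => good k n) (Nat.zero_le n) (hgood0 n)
  have hKlim : Filter.Tendsto K Filter.atTop Filter.atTop := by
    refine Filter.tendsto_atTop.2 fun k => ?_
    rcases Nat.eq_zero_or_pos k with rfl | hk
    · exact Filter.Eventually.of_forall fun _ => Nat.zero_le _
    obtain ⟨N, hN⟩ := h (1 / k) (by positivity)
    filter_upwards [Filter.eventually_ge_atTop (max k N)] with n hn
    refine Nat.le_findGreatest ((le_max_left _ _).trans hn) ?_
    obtain ⟨J, hJ, c, hc, hrate⟩ := hN n ((le_max_right _ _).trans hn)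
    exact ⟨J, hJ, c, Or.inr ⟨hc, hrate⟩⟩
  choose J hJ c hc using hK
  have hKinv : Filter.Tendsto (fun n => (1 : ℝ) / K n) Filter.atTop (nhds 0) :=
    tendsto_one_div_atTop_nhds_zero_nat.comp hKlim
  have hcg : ∀ᶠ n in Filter.atTop, (c n).IsGood W V (1 / K n) ∧
      n * (R - 1 / K n) ≤ Real.logb 2 (J n) := by
    filter_upwards [hKlim.eventually_gt_atTop 0] with n hn
    exact (hc n).resolve_left hn.ne'
  refine ⟨hR, J, c, hJ, ?_, ?_, ?_⟩
  · refine tendsto_of_tendsto_of_tendsto_of_le_of_le' tendsto_const_nhds hKinv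
      (Filter.Eventually.of_forall fun n => (c n).error_nonneg W) ?_
    filter_upwards [hcg] with n hn
    exact ((Code.isGood_iff (hJ n) _ _ _ _).1 hn.1).1
  · have hlim : Filter.Tendsto (fun n => ((R - 1 / K n : ℝ) : EReal)) Filter.atTop
        (nhds (R : EReal)) := by
      refine (continuous_coe_real_ereal.tendsto R).comp ?_
      simpa using hKinv.const_sub R
    rw [← hlim.liminf_eq]
    refine Filter.liminf_le_liminf ?_
    filter_upwards [hcg, Filter.eventually_gt_atTop 0] with n hn hn0
    have h6 : (0 : ℝ) < n := Nat.cast_pos.2 hn0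
    rw [EReal.coe_le_coe_iff, one_div_mul_eq_div, le_div_iff₀ h6]
    linarith [hn.2]
  · refine tendsto_of_tendsto_of_tendsto_of_le_of_le' tendsto_const_nhds hKinv
      (Filter.Eventually.of_forall fun n => (c n).leakage_nonneg (hJ n) V) ?_
    filter_upwards [hcg] with n hn
    exact ((Code.isGood_iff (hJ n) _ _ _ _).1 hn.1).2

lemma EventuallyAchievable.of_nonpos [Nonempty A] {W : θ → Channel A B} {V : θ → Channel A C}
    {R : ℝ} (hR : R ≤ 0) : EventuallyAchievable W V R := fun ε hε => ⟨0, fun n _ => by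
  obtain ⟨c, hc⟩ := exists_isGood_one W V n hε.le
  refine ⟨1, one_pos, c, hc, ?_⟩
  simpa using mul_nonpos_of_nonneg_of_nonpos (Nat.cast_nonneg n) (by linarith : R - ε ≤ 0)⟩

/-- The number of messages of a code with error probabilities below one. -/
lemma Code.IsGood.card_le [Nonempty θ] {W : θ → Channel A B} {V : θ → Channel A C} {n J : ℕ}
    {ε : ℝ} {c : Code A B n J} (hc : c.IsGood W V ε) (hε : ε < 1) : J ≤ Fintype.card B ^ n := by
  -- An empty decoding set would give error probability one. Picking a point in each of the disjoint
  -- sets then injects the messages into the output words.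
  have hne : ∀ j, (c.dec j).Nonempty := fun j => by
    by_contra hcon
    rw [not_nonempty_iff_eq_empty] at hcon
    have h := hc.1 (Classical.arbitrary θ) j
    rw [hcon, compl_empty, sum_congr rfl fun x _ => by
      rw [show ∑ y, memoryless (W (Classical.arbitrary θ)) n x y = 1 from
        (memoryless (W (Classical.arbitrary θ)) n x).2.2, mul_one],
      show ∑ x, c.enc j x = 1 from (c.enc j).2.2] at h
    linarith
  choose y hy using hne
  have hinj : Function.Injective y := fun i j hij => by
    by_contra hne
    exact Finset.disjoint_left.1 (c.disjoint i j hne) (hy i) (hij ▸ hy j)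
  simpa using Fintype.card_le_of_injective y hinj

lemma bddAbove_isAchievable [Fintype θ] [Nonempty A] [Nonempty θ] (W : θ → Channel A B)
    (V : θ → Channel A C) : BddAbove {R | IsAchievable W V R} := by
  refine ⟨Real.logb 2 (Fintype.card B) + 1 / 2, fun R hR => ?_⟩
  obtain ⟨N, hN⟩ := IsAchievable.eventuallyAchievable hR (1 / 2) (by norm_num)
  obtain ⟨J, hJ, c, hc, hrate⟩ := hN (N + 1) (Nat.le_succ N)
  have hcard := hc.card_le (by norm_num)
  have h1 : Real.logb 2 J ≤ (N + 1 : ℕ) * Real.logb 2 (Fintype.card B) := by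
    rw [← Real.logb_pow]
    exact Real.logb_le_logb_of_le one_lt_two (Nat.cast_pos.2 hJ) (by exact_mod_cast hcard)
  have h2 := le_of_mul_le_mul_left (hrate.trans h1) (Nat.cast_pos.2 N.succ_pos)
  linarith

/-- The secrecy capacity is attained. -/
lemma isGreatest_secrecyCapacity [Fintype θ] [Nonempty A] [Nonempty θ] (W : θ → Channel A B)
    (V : θ → Channel A C) :
    IsGreatest {R | IsAchievable W V R} (secrecyCapacity W V) := by
  have h0 : IsAchievable W V 0 := (EventuallyAchievable.of_nonpos le_rfl).isAchievable le_rfl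
  have hbdd := bddAbove_isAchievable W V
  refine ⟨?_, fun R hR => le_csSup hbdd hR⟩
  refine EventuallyAchievable.isAchievable (le_csSup hbdd h0) fun ε hε => ?_
  obtain ⟨R, hR, hlt⟩ := exists_lt_of_lt_csSup ⟨0, h0⟩
    (sub_lt_self (sSup {R | IsAchievable W V R}) (half_pos hε))
  obtain ⟨N, hN⟩ := IsAchievable.eventuallyAchievable hR (ε / 2) (half_pos hε)
  refine ⟨N, fun n hn => ?_⟩
  obtain ⟨J, hJ, c, hc, hrate⟩ := hN n hn
  refine ⟨J, hJ, c, hc.mono (half_le_self hε.le), le_trans ?_ hrate⟩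
  refine mul_le_mul_of_nonneg_left ?_ (Nat.cast_nonneg n)
  have : secrecyCapacity W V = sSup {R | IsAchievable W V R} := rfl
  linarith

lemma EventuallyAchievable.le_secrecyCapacity [Fintype θ] [Nonempty A] [Nonempty θ]
    {W : θ → Channel A B}
    {V : θ → Channel A C} {R : ℝ} (h : EventuallyAchievable W V R) : R ≤ secrecyCapacity W V := by
  have hC := isGreatest_secrecyCapacity W V
  rcases le_total 0 R with hR | hR
  · exact hC.2 (h.isAchievable hR)
  · exact hR.trans hC.1.1

/-- A good code gives a large value of `min_t I(U; Y_t^n) - max_t I(U; Z_t^n)`. -/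
lemma Code.IsGood.exists_mem_blockRateGaps [Nonempty θ] {W : θ → Channel A B}
    {V : θ → Channel A C} {n J : ℕ} (hJ : 0 < J) {ε : ℝ} {c : Code A B n J}
    (hc : c.IsGood W V ε) :
    ∃ r ∈ blockRateGaps W V n, (1 - ε) * Real.logb 2 J - 1 - ε ≤ r := by
  have hJ' : (J : ℝ) ≠ 0 := Nat.cast_ne_zero.2 hJ.ne'
  -- The auxiliary variable is the uniform message itself, with the stochastic encoder as its prefix
  -- channel.
  let P : Dist (Fin J × (Fin n → A)) := ⟨fun i => 1 / (J : ℝ) * c.enc i.1 i.2,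
    fun i => mul_nonneg (by positivity) ((c.enc i.1).2.1 i.2), by
      rw [Fintype.sum_prod_type]
      simp_rw [← mul_sum]
      rw [sum_congr rfl fun j _ => show ∑ x, c.enc j x = 1 from (c.enc j).2.2]
      simp [hJ']⟩
  have hP : ∀ {D : Type _} [Fintype D] (V : Channel A D),
      outputLaw P (memoryless V n) = c.leakLaw V := fun V => by
    funext j z
    simp only [Code.leakLaw, outputLaw, mul_sum, ← mul_assoc]
    rfl
  have hPW : ∀ t, outputLaw P (memoryless (W t) n) =
      fun j y => 1 / (J : ℝ) * compChannel c.enc (memoryless (W t) n) j y := fun t => by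
    funext j z
    simp only [outputLaw, compChannel_apply, mul_sum, ← mul_assoc]
    rfl
  refine ⟨_, ⟨J, P, rfl⟩, ?_⟩
  have h1 : (1 - ε) * Real.logb 2 J - 1 ≤ ⨅ t, mutualInfo (outputLaw P (memoryless (W t) n)) := by
    refine le_ciInf fun t => ?_
    rw [hPW]
    refine fano hJ (fun j y => (compChannel c.enc (memoryless (W t) n) j).2.1 y)
      (fun j => (compChannel c.enc (memoryless (W t) n) j).2.2) c.dec c.disjoint fun j => ?_
    refine le_trans (le_of_eq ?_) (hc.1 t j)
    simp only [mul_sum]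
    exact sum_comm
  have h2 : (⨆ t, mutualInfo (outputLaw P (memoryless (V t) n))) ≤ ε := by
    refine ciSup_le fun t => ?_
    rw [hP]
    exact hc.2 t
  unfold rateGap
  linarith

/-- The capacity as the limit of the normalized block maxima. -/
lemma tendsto_blockRateGaps [Fintype θ] [Nonempty A] [Nonempty θ] (W : θ → Channel A B)
    (V : θ → Channel A C) {M : ℕ → ℝ} (hM : ∀ n, IsGreatest (blockRateGaps W V n) (M n)) :
    Filter.Tendsto (fun n : ℕ => 1 / (n : ℝ) * M n) Filter.atTop
      (nhds (secrecyCapacity W V)) := by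
  set S := secrecyCapacity W V with hS
  have hS0 : 0 ≤ S := (isGreatest_secrecyCapacity W V).1.1
  -- Achievability over blocks bounds every normalised maximum with `n > 0`, not only the limit.
  have hupper : ∀ᶠ n : ℕ in Filter.atTop, 1 / (n : ℝ) * M n ≤ S := by
    filter_upwards [Filter.eventually_gt_atTop 0] with n hn
    obtain ⟨k, P, hP⟩ := (hM n).1
    rw [hP]
    exact (EventuallyAchievable.of_blocks hn
      (eventuallyAchievable_rateGap _ _ P)).le_secrecyCapacity
  rw [Metric.tendsto_atTop]
  intro δ hδ
  -- Fano gives `M n ≥ (1 - ε) n (S - ε) - 1 - ε`. The loss linear in `n` is at most `n ε (S + 1) ≤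
  -- n δ / 4`, and the constant loss of at most `3 / 2` is covered once `δ n ≥ 4`.
  set ε := min (1 / 2) (δ / (4 * (S + 1))) with hε
  have hε0 : 0 < ε := by positivity
  have hε2 : ε ≤ 1 / 2 := min_le_left _ _
  have hεδ : ε * (S + 1) ≤ δ / 4 := by
    have : ε ≤ δ / (4 * (S + 1)) := min_le_right _ _
    rw [le_div_iff₀ (by positivity)] at this
    linarith
  obtain ⟨N, hN⟩ := (isGreatest_secrecyCapacity W V).1.eventuallyAchievable ε hε0
  obtain ⟨N₁, hN₁⟩ := Filter.eventually_atTop.1 hupper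
  obtain ⟨N₂, hN₂⟩ := exists_nat_gt (4 / δ)
  refine ⟨max (max N N₁) (max N₂ 1), fun n hn => ?_⟩
  simp only [ge_iff_le, max_le_iff] at hn
  obtain ⟨J, hJ, c, hc, hrate⟩ := hN n hn.1.1
  obtain ⟨r, hr, hle⟩ := hc.exists_mem_blockRateGaps hJ
  have hMr := (hM n).2 hr
  have hn0 : (0 : ℝ) < n := Nat.cast_pos.2 hn.2.2
  have hup := hN₁ n hn.1.2
  have h4 : 4 ≤ δ * n := by
    have h1 : (N₂ : ℝ) ≤ n := by exact_mod_cast hn.2.1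
    have h2 := hN₂.le.trans h1
    rw [div_le_iff₀ hδ] at h2
    linarith
  rw [Real.dist_eq, abs_sub_lt_iff]
  refine ⟨by linarith, ?_⟩
  have h5 : S - δ < 1 / (n : ℝ) * M n := by
    rw [one_div_mul_eq_div, lt_div_iff₀ hn0]
    have h6 : (1 - ε) * (n * (S - ε)) ≤ (1 - ε) * Real.logb 2 J :=
      mul_le_mul_of_nonneg_left hrate (by linarith)
    have h7 : (1 - ε) * (n * (S - ε)) = n * S - n * (ε * (S + 1)) + n * ε ^ 2 := by ring
    have h8 : n * (ε * (S + 1)) ≤ n * (δ / 4) := mul_le_mul_of_nonneg_left hεδ hn0.le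
    have h9 : 0 ≤ n * ε ^ 2 := by positivity
    have h10 : 0 < n * δ := by positivity
    linarith
  linarith

end Capacity

/-! ### Existence of the maximum over auxiliary variables. -/

/-- The convex hull of a compact set in a finite-dimensional space is compact. -/
lemma isCompact_convexHull_of_finiteDimensional {E : Type*} [NormedAddCommGroup E]
    [NormedSpace ℝ E] [FiniteDimensional ℝ E] {s : Set E} (hs : IsCompact s) :
    IsCompact (convexHull ℝ s) := by
  rcases s.eq_empty_or_nonempty with rfl | ⟨x₀, hx₀⟩
  · simp
  -- By Carathéodory's theorem `d` points suffice, so the hull is the continuous image of a compact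
  -- product. Shorter combinations are padded with weight zero at `x₀`.
  set d := Module.finrank ℝ E + 1
  have hcomp : IsCompact (stdSimplex ℝ (Fin d) ×ˢ Set.univ.pi fun _ : Fin d => s) :=
    (isCompact_stdSimplex ℝ (Fin d)).prod (isCompact_univ_pi fun _ => hs)
  have hcont : Continuous fun q : (Fin d → ℝ) × (Fin d → E) => ∑ i, q.1 i • q.2 i := by fun_prop
  convert hcomp.image hcont using 1
  ext x
  constructor
  · intro hx
    obtain ⟨ι, _, z, w, hz, hind, hw, hw1, rfl⟩ := eq_pos_convex_span_of_mem_convexHull hx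
    have hcard : Fintype.card ι ≤ Fintype.card (Fin d) := by
      rw [Fintype.card_fin]
      exact hind.card_le_finrank_succ.trans (Nat.succ_le_succ (Submodule.finrank_le _))
    obtain ⟨e⟩ := Function.Embedding.nonempty_of_card_le hcard
    have hne : ∀ i ∉ Set.range e, Function.extend e w 0 i = 0 := fun i hi =>
      Function.extend_apply' _ _ _ hi
    refine ⟨(Function.extend e w 0, Function.extend e z fun _ => x₀), ⟨⟨fun i => ?_, ?_⟩,
      fun i _ => ?_⟩, ?_⟩
    · dsimp only
      by_cases hi : i ∈ Set.range e
      · obtain ⟨k, rfl⟩ := hi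
        rw [e.injective.extend_apply]
        exact (hw k).le
      · rw [hne i hi]
    · rw [← hw1]
      exact (Fintype.sum_of_injective e e.injective _ _ hne
        fun i => (e.injective.extend_apply _ _ _).symm).symm
    · dsimp only
      by_cases hi : i ∈ Set.range e
      · obtain ⟨k, rfl⟩ := hi
        rw [e.injective.extend_apply]
        exact hz ⟨k, rfl⟩
      · rw [Function.extend_apply' _ _ _ hi]
        exact hx₀
    · refine (Fintype.sum_of_injective e e.injective _ _ (fun i hi => ?_) fun i => ?_).symm
      · simp only [hne i hi, zero_smul]
      · simp only [e.injective.extend_apply]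
  · rintro ⟨⟨w, z⟩, ⟨hw, hz⟩, rfl⟩
    exact mem_convexHull_of_exists_fintype w z hw.1 hw.2 (fun i => hz i (Set.mem_univ i)) rfl

section Maximum

variable {θ A B C : Type*} [Fintype A] [Fintype B] [Fintype C]

/-- The entropy, in bits, of the output of `W` for the input weight `x`. -/
noncomputable def outputEntropy (W : Channel A B) (x : A → ℝ) : ℝ :=
  (∑ y, Real.negMulLog (outputDist x W y)) / Real.log 2

lemma continuous_outputEntropy (W : Channel A B) : Continuous (outputEntropy W) := by
  unfold outputEntropy outputDist
  refine (continuous_finsetSum _ fun y _ => Real.continuous_negMulLog.comp ?_).div_const _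
  fun_prop

/-- `I(U; Y) = H(Y) - H(Y | U)`. -/
lemma mutualInfo_eq_outputEntropy_sub {υ : Type*} [Fintype υ] {p : υ → ℝ} (hp : ∀ u, 0 ≤ p u)
    (G : Channel υ A) (W : Channel A B) :
    mutualInfo (fun u y => p u * compChannel G W u y) =
      outputEntropy W (∑ u, p u • ⇑(G u)) - ∑ u, p u * outputEntropy W (G u) := by
  have h2 : Real.log 2 ≠ 0 := (Real.log_pos one_lt_two).ne'
  rw [← mul_left_inj' h2, mutualInfo_joint_mul_log_two hp, sub_mul, sum_mul]
  have hq : ∀ y, outputDist (∑ u, p u • ⇑(G u)) W y = outputDist p (compChannel G W) y := by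
    intro y
    simp only [outputDist, compChannel_apply, Finset.sum_apply, Pi.smul_apply, smul_eq_mul, sum_mul,
      mul_sum, mul_assoc]
    exact sum_comm
  have h3 : ∀ u, p u * outputEntropy W (G u) * Real.log 2 =
      ∑ y, p u * Real.negMulLog (compChannel G W u y) := fun u => by
    rw [outputEntropy, mul_assoc, div_mul_cancel₀ _ h2, mul_sum]
    rfl
  simp_rw [h3]
  rw [outputEntropy, div_mul_cancel₀ _ h2]
  simp_rw [hq]
  have h4 : ∑ y, Real.negMulLog (outputDist p (compChannel G W) y) =
      -∑ u, ∑ y, p u * compChannel G W u y * Real.log (outputDist p (compChannel G W) y) := by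
    rw [sum_comm, ← sum_neg_distrib]
    refine sum_congr rfl fun y _ => ?_
    rw [← sum_mul, Real.negMulLog, neg_mul]
    rfl
  rw [h4, neg_sub_left, ← sum_add_distrib, ← sum_neg_distrib]
  refine sum_congr rfl fun u _ => ?_
  rw [← sum_add_distrib, ← sum_neg_distrib]
  refine sum_congr rfl fun y _ => ?_
  rcases (mul_nonneg (hp u) ((compChannel G W u).2.1 y)).eq_or_lt with h | h
  · have h' : p u * compChannel G W u y = 0 := h.symm
    rw [Real.negMulLog, ← mul_assoc, mul_neg, h']
    simp
  · change 0 < p u * compChannel G W u y at h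
    rw [Real.log_div (pos_of_mul_pos_right h (hp u)).ne' (outputDist_pos hp h).ne', Real.negMulLog]
    ring

/-- The point `(x, (H(x W_t))_t, (H(x V_t))_t)`. -/
noncomputable def entropyPoint (W : θ → Channel A B) (V : θ → Channel A C) (x : A → ℝ) :
    (A → ℝ) × (θ → ℝ) × (θ → ℝ) :=
  (x, fun t => outputEntropy (W t) x, fun t => outputEntropy (V t) x)

/-- The value of `min_t I(U; Y_t) - max_t I(U; Z_t)` as a function of the law of `X` and of the
conditional output entropies given `U`. -/
noncomputable def gapFunction (W : θ → Channel A B) (V : θ → Channel A C)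
    (z : (A → ℝ) × (θ → ℝ) × (θ → ℝ)) : ℝ :=
  (⨅ t, (outputEntropy (W t) z.1 - z.2.1 t)) - ⨆ t, (outputEntropy (V t) z.1 - z.2.2 t)

lemma continuous_gapFunction [Fintype θ] [Nonempty θ] (W : θ → Channel A B) (V : θ → Channel A C) :
    Continuous (gapFunction W V) := by
  unfold gapFunction
  simp_rw [← inf'_univ_eq_ciInf, ← sup'_univ_eq_ciSup]
  refine Continuous.sub (Continuous.finset_inf'_apply _ fun t _ => ?_)
    (Continuous.finset_sup'_apply _ fun t _ => ?_)
  · exact ((continuous_outputEntropy (W t)).comp continuous_fst).sub (by fun_prop)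
  · exact ((continuous_outputEntropy (V t)).comp continuous_fst).sub (by fun_prop)

lemma rateGap_eq_gapFunction {υ : Type*} [Fintype υ] {P : Dist (υ × A)} {p : υ → ℝ}
    {G : Channel υ A} (hp : ∀ u, 0 ≤ p u) (h : ∀ u x, P (u, x) = p u * G u x)
    (W : θ → Channel A B) (V : θ → Channel A C) :
    rateGap W V P = gapFunction W V (∑ u, p u • entropyPoint W V (G u)) := by
  simp only [rateGap, gapFunction, outputLaw_eq h, mutualInfo_eq_outputEntropy_sub hp,
    entropyPoint, Prod.smul_mk, Prod.fst_sum, Prod.snd_sum, Finset.sum_apply, Pi.smul_apply,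
    smul_eq_mul]

/-- The maximum over all auxiliary variables is attained. -/
theorem exists_isGreatest_rateGaps [Fintype θ] [Nonempty θ] [Nonempty A] (W : θ → Channel A B)
    (V : θ → Channel A C) : ∃ M, IsGreatest (rateGaps W V) M := by
  have hF : Continuous (entropyPoint W V) := by
    refine continuous_id.prodMk (Continuous.prodMk ?_ ?_) <;>
    exact continuous_pi fun t => continuous_outputEntropy _
  -- A finite-valued `U` is a finite convex combination of input laws, so averaging entropy points
  -- over `U` sweeps out exactly the convex hull. Compactness of the hull replaces an explicit bound
  -- on the number of values of `U`.
  have hset : rateGaps W V =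
      gapFunction W V '' convexHull ℝ (entropyPoint W V '' stdSimplex ℝ A) := by
    ext r
    constructor
    · rintro ⟨k, P, rfl⟩
      obtain ⟨p, G, hp, hp1, hPG⟩ := exists_prefix P
      exact ⟨_, mem_convexHull_of_exists_fintype p (fun u => entropyPoint W V (G u)) hp hp1
        (fun u => ⟨_, (G u).2, rfl⟩) rfl, (rateGap_eq_gapFunction hp hPG W V).symm⟩
    · rintro ⟨z, hz, rfl⟩
      obtain ⟨ι, _, w, z, hw, hw1, hmem, rfl⟩ := mem_convexHull_iff_exists_fintype.1 hz
      choose x hx hxz using fun i => (Set.mem_image _ _ _).1 (hmem i)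
      let e := (Fintype.equivFin ι).symm
      let G : Channel (Fin (Fintype.card ι)) A := fun i => ⟨x (e i), hx (e i)⟩
      let P : Dist (Fin (Fintype.card ι) × A) := ⟨fun i => w (e i.1) * G i.1 i.2,
        fun i => mul_nonneg (hw _) ((G i.1).2.1 i.2), by
          rw [Fintype.sum_prod_type]
          simp_rw [← mul_sum]
          rw [sum_congr rfl fun i _ => by
            rw [show ∑ a, G i a = 1 from (G i).2.2, mul_one], e.sum_comp w, hw1]⟩
      refine ⟨_, P, ?_⟩
      rw [rateGap_eq_gapFunction (p := fun i => w (e i)) (G := G) (fun i => hw _)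
        (fun _ _ => rfl) W V, ← e.sum_comp]
      congr 1
      refine sum_congr rfl fun i _ => ?_
      rw [← hxz]
      rfl
  rw [hset]
  refine ((isCompact_convexHull_of_finiteDimensional
    ((isCompact_stdSimplex ℝ A).image hF)).image (continuous_gapFunction W V)).exists_isGreatest ?_
  obtain ⟨d⟩ := exists_dist A
  exact (convexHull_nonempty_iff.2 (Set.Nonempty.image _ ⟨_, d.2⟩)).image _

end Maximum

end CompoundWiretap

/-- The first conjunct says that the secrecy capacity is indeed the largest achievable secrecy
rate; the second and third say that the maxima over `U` exist. -/
theorem theorem2 {θ A B C : Type*} [Fintype θ] [Nonempty θ] [Fintype A] [Nonempty A]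
    [Fintype B] [DecidableEq B] [Fintype C]
    (W : θ → CompoundWiretap.Channel A B) (V : θ → CompoundWiretap.Channel A C) :
    IsGreatest {R | CompoundWiretap.IsAchievable W V R} (CompoundWiretap.secrecyCapacity W V) ∧
    (∃ M : ℝ, IsGreatest (CompoundWiretap.rateGaps W V) M ∧
      M ≤ CompoundWiretap.secrecyCapacity W V) ∧
    ∃ M : ℕ → ℝ, (∀ n, IsGreatest (CompoundWiretap.blockRateGaps W V n) (M n)) ∧
      ∃ L : ℝ, Filter.Tendsto (fun n : ℕ => 1 / (n : ℝ) * M n) Filter.atTop (nhds L) ∧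
        L ≤ CompoundWiretap.secrecyCapacity W V ∧
        CompoundWiretap.secrecyCapacity W V ≤ L := by
  refine ⟨CompoundWiretap.isGreatest_secrecyCapacity W V, ?_, ?_⟩
  · obtain ⟨M, hM⟩ := CompoundWiretap.exists_isGreatest_rateGaps W V
    obtain ⟨k, P, hP⟩ := hM.1
    refine ⟨M, hM, ?_⟩
    rw [hP]
    exact (CompoundWiretap.eventuallyAchievable_rateGap W V P).le_secrecyCapacity
  · choose M hM using fun n => CompoundWiretap.exists_isGreatest_rateGaps
      (fun t => CompoundWiretap.memoryless (W t) n) (fun t => CompoundWiretap.memoryless (V t) n)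
    -- The limit is the capacity itself, so both inequalities are equalities.
    exact ⟨M, hM, _, CompoundWiretap.tendsto_blockRateGaps W V hM, le_rfl, le_rfl⟩
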